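/- **Setting.** Let $\mathfrak S$ be a measurable state space, $\mathfrak A$ a finite non-empty action set, $\mathfrak Z=\mathfrak S\times\mathfrak A$, and let $\mathcal H$ be a reproducing kernel Hilbert space of real functions on $\mathfrak Z$ with kernel $\kappa$ and measurable feature map $\varphi(z)=\kappa(z,\cdot)$. Let $g\in\mathcal H$ be the one-step loss, $\alpha>0$ the discount factor, and $P(\cdot\mid z)$, $z\in\mathfrak Z$, the transition probability on $\mathfrak S$. The classical Bellman maps are $$(T_\nu^\diamond Q)(z)=g(z)+\alpha\,\mathbb E_{s'\mid z}\{Q(s',\nu(s'))\},\qquad (T^\diamond Q)(z)=g(z)+\alpha\,\mathbb E_{s'\mid z}\{\inf_{a}Q(s',a)\},$$ for policies $\nu:\mathfrak S\to\mathfrak A$. Let $Q_\nu^\diamond\in\mathcal H$ and $Q_*^\diamond\in\mathcal H$ denote fixed points of $T_\nu^\diamond$ and $T^\diamond$. For operators, $\sigma_{\min}(\mathcal C)=\inf_{\|h\|=1}\langle h,\mathcal C h\rangle$, and expectations of $\mathcal H$-valued quantities are in the weak (Riesz) sense. **Algorithm (no experience replay).** $Q_0$ is square integrable (e.g. deterministic),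 $z_{-1}=(s_{-1},a_{-1})$ is an arbitrary initial pair, and $\mathfrak B_{-1}$ is a finite deterministic buffer. For $n=0,1,2,\dots$: $s_n=s_{n-1}'(a_{n-1})$ is the state that follows $s_{n-1}$, where $s_{n-1}'(a)$ is the (random) state that would follow if action $a$ were taken; $\mu_n(s)\in\arg\min_a Q_n(s,a)$, $a_n=\mu_n(s_n)$, $z_n=(s_n,a_n)$. If $\mathrm{dist}_{\mathfrak S}(s_{n-1},\bar s)>\delta_{\mathfrak S}$ for all $(\bar s,\bar a,\bar s')\in\mathfrak B_{n-1}$, then $\mathfrak B_n=\mathfrak B_{n-1}\cup\{(s_{n-1},a_{n-1},s_n)\}\cup\{(s_{n-1},a,s_{n-1}'(a)):a\in\mathfrak A\}$; otherwise $\mathfrak B_n=\mathfrak B_{n-1}$. The trajectory samples $\mathcal T^{(n)}=\{(s_i,a_i,s_i')\}_{i=1}^{N[n]}$ are the set of those $(\bar s,\bar a,\bar s')\in\mathfrak B_n$ with $\mathrm{dist}_{\mathfrak Z}(z_{n-1},(\bar s,\bar a))\le\delta_{\mathfrak Z}$, together with $(s_{n-1},a_{n-1},s_n)$. With $N=N[n]$,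 $\Phi=[\varphi(s_i,a_i)]_{i}$, $K=\Phi^\intercal\Phi$, $\Phi_{\mu_n}^{\rm av}=[\varphi(s_i',\mu_n(s_i'))]_{i}$ and regularization coefficients $\sigma'_N>0$, set $$\hat\Sigma_{s'\mid z}^{\mu_n}(N[n])=\tfrac1{\sqrt N}\Phi\bigl(\tfrac1N K+\sigma'_N I_N\bigr)^{-1}\tfrac1{\sqrt N}\Phi_{\mu_n}^{{\rm av}\,\intercal},\qquad T^{(n)}_{\mu_n}(Q)=g+\alpha\hat\Sigma_{s'\mid z}^{\mu_n}(N[n])\,Q,$$ $$Q_{n+1}=Q_n-\eta\nabla\mathcal L^{(n)}(Q_n),\qquad \mathcal L^{(n)}(Q)=\tfrac12\langle T^{(n)}_{\mu_n}(Q)-Q,\varphi(z_{n-1})\rangle^2 .$$ For large $n$ the conditional law of $s_n$ given $z_{n-1}$ is $P(\cdot\mid z_{n-1})$. Put $\Sigma_{s'\mid z}^{\nu}=\Sigma_{zz}^{-1}\Sigma_{s'z}^{\nu}$ with $\Sigma_{zz}f=\mathbb E\{\langle\varphi(z),f\rangle\varphi(z)\}$, $\Sigma_{s'z}^\nu f=\mathbb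 E\{\langle\varphi(s',\nu(s')),f\rangle\varphi(z)\}$ at $(z,s')=(z_{n-1},s_n)$, and $$\xi_n=\bigl(\hat\Sigma_{s'\mid z}^{\mu_n}(N[n])-\Sigma_{s'\mid z}^{\mu_n}\bigr)^*\varphi(z_{n-1}).$$ **Assumptions.** (All random quantities are measurable.) 1. There is a (measurable) policy $\mu$ with $\mu_n=\mu$ a.s. for all sufficiently large $n$. 2. There is $\beta_\infty\in(0,1)$ such that, for all sufficiently large $n$, a.s., $T_{\mu_n}^\diamond$ maps $\mathcal H$ into itself and is a $\beta_\infty$-contraction there. 3. For all sufficiently large $n$, $\sigma(\{z_{n-1},\xi_n\})$ is independent of $\sigma(Q_0,\dots,Q_n)$. 4. $\mathbb E\|\xi_n\|^4=\mathfrak m_\xi^{(4)}\in(0,\infty)$ for all sufficiently large $n$. 5. There are bounded operators $\Sigma_{zz},\Sigma_{\xi z},\Sigma_{\xi\xi}$ on $\mathcal H$ such that, for all sufficiently large $n$, $\Sigma_{zz}f=\mathbb E\{\langle\varphi(z_n),f\rangle\varphi(z_n)\}$, $\Sigma_{\xi z}f=\mathbb E\{\langle\varphi(z_{n-1}),f\rangle\xi_n\}$,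 $\Sigma_{\xi\xi}f=\mathbb E\{\langle\xi_n,f\rangle\xi_n\}$. 6. $\sigma_{\min}(\Sigma_{zz})>0$ and, for all sufficiently large $n$ (a.s.), $\sigma_{\min}(\mathcal A_{\mu_n})>0$, where, with $D_n=\alpha\Sigma_{s'\mid z}^{\mu_n}-\mathrm{Id}$, $\mathcal A_{\mu_n}=D_n^*\Sigma_{zz}D_n+\alpha^2\Sigma_{\xi\xi}+\alpha\Sigma_{\xi z}D_n+\alpha D_n^*\Sigma_{\xi z}^*$. 7. $\kappa(z,z)\le B_\kappa<\infty$ for all $z\in\mathfrak Z$. **Theorem.** Fix $\mathfrak S,\mathfrak A,\mathcal H,g,\alpha,P$ and the limiting data $\mu,\beta_\infty,\mathfrak m_\xi^{(4)},\Sigma_{zz},\Sigma_{\xi z},\Sigma_{\xi\xi},B_\kappa$. There are $\eta_0,\Delta_4,\Delta_5>0$, depending only on these, such that for every step size $\eta\in(0,\eta_0)$ and every run of the algorithm with step size $\eta$, on any probability space, that satisfies the assumptions with these data, $$\limsup_{n\to\infty}\mathbb E\|Q_n-Q_*^\diamond\|^2\le\Delta_4\,\eta+\Delta_5\limsup_{n\to\infty}\mathbb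 E\bigl\|\Sigma_{s'\mid z}^{\mu_n}-\hat\Sigma_{s'\mid z}^{\mu_n}(N[n])\bigr\|^2+2\limsup_{n\to\infty}\mathbb E\|Q_{\mu_n}^\diamond-Q_*^\diamond\|^2,$$ where $Q_{\mu_n}^\diamond$ (for large $n$) is a fixed point of $T_{\mu_n}^\diamond$ and $Q_*^\diamond$ any fixed point of $T^\diamond$ (all sides in $[0,\infty]$). -/

import Mathlib

open MeasureTheory ProbabilityTheory Filter
open scoped ENNReal InnerProductSpace

noncomputable section

namespace BellmanRKHS

/-! ### Feature map, classical Bellman maps -/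

/-- The feature map `φ(x) = κ(x, ·)` of a real-valued reproducing kernel Hilbert space `H` of
functions on `X`; thus `⟪f, φ x⟫ = f x` and `κ(x, y) = ⟪φ x, φ y⟫`. -/
def feature (H : Type*) {X : Type*} [NormedAddCommGroup H] [InnerProductSpace ℝ H]
    [CompleteSpace H] [RKHS ℝ H X ℝ] (x : X) : H :=
  RKHS.kerFun H x 1

/-- The classical Bellman map of a stationary policy `ν`:
`(T_ν Q)(z) = g(z) + α 𝔼[Q(s', ν(s')) | z]`, where `s'` has law `K z`. -/
def bellmanPolicy {S A : Type*} [MeasurableSpace S] [MeasurableSpace A]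
    (K : Kernel (S × A) S) (g : S × A → ℝ) (α : ℝ) (ν : S → A) (Q : S × A → ℝ) :
    S × A → ℝ :=
  fun z => g z + α * ∫ s', Q (s', ν s') ∂(K z)

/-- The classical greedy Bellman map
`(T Q)(z) = g(z) + α 𝔼[inf_a Q(s', a) | z]`, where `s'` has law `K z`. -/
def bellmanGreedy {S A : Type*} [MeasurableSpace S] [MeasurableSpace A]
    (K : Kernel (S × A) S) (g : S × A → ℝ) (α : ℝ) (Q : S × A → ℝ) : S × A → ℝ :=
  fun z => g z + α * ∫ s', (⨅ a, Q (s', a)) ∂(K z)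

/-- `T` maps the function space `H` into itself and is a `β`-contraction there. -/
def IsContractionOn (H : Type*) {X : Type*} [NormedAddCommGroup H] [InnerProductSpace ℝ H]
    [RKHS ℝ H X ℝ] (T : (X → ℝ) → (X → ℝ)) (β : ℝ) : Prop :=
  ∃ F : H → H, (∀ Q : H, (F Q : X → ℝ) = T (Q : X → ℝ)) ∧
    ∀ Q₁ Q₂ : H, ‖F Q₁ - F Q₂‖ ≤ β * ‖Q₁ - Q₂‖

/-- The element `Q` of `H` is a fixed point of the map `T` on functions. -/
def IsFixedPointIn {H X : Type*} [NormedAddCommGroup H] [InnerProductSpace ℝ H]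
    [RKHS ℝ H X ℝ] (T : (X → ℝ) → (X → ℝ)) (Q : H) : Prop :=
  T (Q : X → ℝ) = (Q : X → ℝ)

/-! ### Operators on the Hilbert space -/

section Operators

variable {H : Type*} [NormedAddCommGroup H] [InnerProductSpace ℝ H]

/-- Minimum spectral value `σ_min(C) = inf_{‖h‖ = 1} ⟪h, C h⟫`. -/
def sigmaMin (C : H →L[ℝ] H) : ℝ :=
  ⨅ h : {h : H // ‖h‖ = 1}, ⟪(h : H), C (h : H)⟫_ℝ

variable {Ω : Type*} [MeasurableSpace Ω]

/-- `C f = 𝔼[⟪X, f⟫ Y]` for all `f`, the expectation being taken in the weak (Riesz) sense. -/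
def IsCrossCov (Pr : Measure Ω) (X Y : Ω → H) (C : H →L[ℝ] H) : Prop :=
  ∀ f h : H, Integrable (fun ω => ⟪X ω, f⟫_ℝ * ⟪Y ω, h⟫_ℝ) Pr ∧
    ⟪C f, h⟫_ℝ = ∫ ω, ⟪X ω, f⟫_ℝ * ⟪Y ω, h⟫_ℝ ∂Pr

open Classical in
/-- The (unique) bounded operator `f ↦ 𝔼[⟪X, f⟫ Y]` if there is one, and `0` otherwise. -/
def crossCov (Pr : Measure Ω) (X Y : Ω → H) : H →L[ℝ] H :=
  if hC : ∃ C : H →L[ℝ] H, IsCrossCov Pr X Y C then hC.choose else 0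

variable [CompleteSpace H]

/-- The operator
`(αC - I)^* Σ_zz (αC - I) + α² Σ_ξξ + α Σ_ξz (αC - I) + α (αC - I)^* Σ_ξz^*`. -/
def curvature (α : ℝ) (C Szz Sxz Sxx : H →L[ℝ] H) : H →L[ℝ] H :=
  (α • C - .id ℝ H).adjoint ∘L Szz ∘L (α • C - .id ℝ H) + α ^ 2 • Sxx
    + α • (Sxz ∘L (α • C - .id ℝ H))
    + α • ((α • C - .id ℝ H).adjoint ∘L Sxz.adjoint)

end Operators

/-! ### Sampled conditional operator, sampled Bellman map and loss

A finite set `T` of trajectory samples `(s_i, a_i, s_i')` is used, with `z_i = (s_i, a_i)`. -/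

section Sampled

variable {H S A : Type*} [NormedAddCommGroup H] [InnerProductSpace ℝ H] [CompleteSpace H]
  [RKHS ℝ H (S × A) ℝ]

/-- The kernel matrix with entries `κ(z_i, z_j)`. -/
def gram (H : Type*) [NormedAddCommGroup H] [InnerProductSpace ℝ H] [CompleteSpace H]
    [RKHS ℝ H (S × A) ℝ] (T : Finset (S × A × S)) : Matrix T T ℝ :=
  Matrix.of fun i j =>
    ⟪feature H (i.1.1, i.1.2.1), feature H (j.1.1, j.1.2.1)⟫_ℝ

open Classical in
/-- With `N` the number of samples, `N^{-1/2} Φ (N^{-1} K + σ'_N I)^{-1} N^{-1/2} (Φ_ν)^⊺`, where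
the columns of `Φ` are `φ(z_i)`, those of `Φ_ν` are `φ(s_i', ν(s_i'))`, and `K = Φ^⊺ Φ`. -/
def condEstimate (reg : ℕ → ℝ) (ν : S → A) (T : Finset (S × A × S)) : H →L[ℝ] H :=
  (T.card : ℝ)⁻¹ • ∑ i : T, ∑ j : T,
    (((T.card : ℝ)⁻¹ • gram H T + reg T.card • (1 : Matrix T T ℝ))⁻¹ i j) •
      InnerProductSpace.rankOne ℝ (feature H (i.1.1, i.1.2.1))
        (feature H (j.1.2.2, ν j.1.2.2))

/-- The sampled Bellman map `Q ↦ g + α Φ (K + N σ'_N I)^{-1} (Φ_ν)^⊺ Q`. -/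
def sampledBellman (g : H) (α : ℝ) (reg : ℕ → ℝ) (ν : S → A) (T : Finset (S × A × S))
    (Q : H) : H :=
  g + α • condEstimate reg ν T Q

/-- The quadratic loss `½ ⟪T(Q) - Q, φ(z)⟫²` of the sampled Bellman map `T`. -/
def loss (g : H) (α : ℝ) (reg : ℕ → ℝ) (ν : S → A) (T : Finset (S × A × S)) (z : S × A)
    (Q : H) : ℝ :=
  (1 / 2) * ⟪sampledBellman g α reg ν T Q - Q, feature H z⟫_ℝ ^ 2

end Sampled

/-! ### The algorithm without experience replay -/

/-- User-defined parameters of the construction of the trajectory samples. -/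
structure SamplingParams (S A : Type*) where
  /-- distance on states, and the novelty threshold for the buffer -/
  distS : S → S → ℝ
  thrS : ℝ
  /-- distance on state-action pairs, and the similarity threshold for trajectory samples -/
  distZ : S × A → S × A → ℝ
  thrZ : ℝ
  /-- regularization coefficients `σ'_N` -/
  reg : ℕ → ℝ
  reg_pos : ∀ N, 1 ≤ N → 0 < reg N
  /-- initial content of the buffer -/
  buffer₀ : Finset (S × A × S)

/-- The random quantities that appear in a run of the algorithm. -/
structure Run (Ω H S A : Type*) where
  /-- the estimates `Q_n` -/
  Q : ℕ → Ω → H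
  /-- the policies `μ_n` -/
  policy : ℕ → Ω → S → A
  /-- `prev n` is the state-action pair `z_{n-1} = (s_{n-1}, a_{n-1})` -/
  prev : ℕ → Ω → S × A
  /-- `succ n ω a` is the state that follows `s_{n-1}` if action `a` is taken in it -/
  succ : ℕ → Ω → A → S
  /-- `buffer n` is the buffer `𝔅_{n-1}`; the one-step loss `g(s, a)` of a tuple is omitted, as
  it is a function of the tuple -/
  buffer : ℕ → Ω → Finset (S × A × S)

namespace Run

variable {Ω H S A : Type*}

/-- The new state `s_n = s_{n-1}'`. -/
def state (R : Run Ω H S A) (n : ℕ) (ω : Ω) : S := R.succ n ω (R.prev n ω).2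

open Classical in
/-- The trajectory samples of time `n`: the tuples of `𝔅_n` whose state-action pair is similar to
`z_{n-1}`, together with `(s_{n-1}, a_{n-1}, s_n)`. -/
def samples (R : Run Ω H S A) (p : SamplingParams S A) (n : ℕ) (ω : Ω) : Finset (S × A × S) :=
  insert ((R.prev n ω).1, (R.prev n ω).2, R.state n ω)
    ((R.buffer (n + 1) ω).filter fun b => p.distZ (R.prev n ω) (b.1, b.2.1) ≤ p.thrZ)

open Classical in
/-- The equations of the algorithm without experience replay, with step size `η`: greedy policy
improvement, update of the buffer by a sufficiently novel state and all its possible successors,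
and one gradient step on the loss of the sampled Bellman map. -/
structure IsRun [Fintype A] [NormedAddCommGroup H] [InnerProductSpace ℝ H] [CompleteSpace H]
    [RKHS ℝ H (S × A) ℝ] (R : Run Ω H S A) (p : SamplingParams S A) (g : H) (α η : ℝ) : Prop where
  greedy : ∀ n ω s a, (R.Q n ω) (s, R.policy n ω s) ≤ (R.Q n ω) (s, a)
  pair : ∀ n ω, R.prev (n + 1) ω = (R.state n ω, R.policy n ω (R.state n ω))
  buffer_zero : ∀ ω, R.buffer 0 ω = p.buffer₀
  buffer_succ : ∀ n ω, R.buffer (n + 1) ω =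
    if ∀ b ∈ R.buffer n ω, p.thrS < p.distS (R.prev n ω).1 b.1 then
      R.buffer n ω ∪ {((R.prev n ω).1, (R.prev n ω).2, R.state n ω)} ∪
        Finset.univ.image fun a => ((R.prev n ω).1, a, R.succ n ω a)
    else R.buffer n ω
  update : ∀ n ω, R.Q (n + 1) ω =
    R.Q n ω - η • gradient
      (loss g α p.reg (R.policy n ω) (R.samples p n ω) (R.prev n ω)) (R.Q n ω)

section Probability

variable [MeasurableSpace Ω] [NormedAddCommGroup H] [InnerProductSpace ℝ H] [CompleteSpace H]
  [RKHS ℝ H (S × A) ℝ]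

/-- The operator `Σ_{s'|z}^ν = Σ_zz⁻¹ Σ_{s'z}^ν` for `z = z_{n-1}`, `s' = s_n`, where
`Σ_zz f = 𝔼[⟪φ(z), f⟫ φ(z)]` and `Σ_{s'z}^ν f = 𝔼[⟪φ(s', ν(s')), f⟫ φ(z)]`. -/
def condOp (R : Run Ω H S A) (Pr : Measure Ω) (n : ℕ) (ν : S → A) : H →L[ℝ] H :=
  (crossCov Pr (fun ω => feature H (R.prev n ω)) (fun ω => feature H (R.prev n ω))).inverse ∘L
    crossCov Pr (fun ω => feature H (R.state n ω, ν (R.state n ω)))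
      (fun ω => feature H (R.prev n ω))

/-- The sample estimate of the operator `Σ_{s'|z}^{μ_n}` at time `n`. -/
def condOpEst (R : Run Ω H S A) (p : SamplingParams S A) (n : ℕ) (ω : Ω) : H →L[ℝ] H :=
  condEstimate p.reg (R.policy n ω) (R.samples p n ω)

/-- `ξ_n`, the adjoint of (estimate minus `Σ_{s'|z}^{μ_n}`) applied to `φ(z_{n-1})`. -/
def xi (R : Run Ω H S A) (Pr : Measure Ω) (p : SamplingParams S A) (n : ℕ) (ω : Ω) : H :=
  (R.condOpEst p n ω - R.condOp Pr n (R.policy n ω)).adjoint (feature H (R.prev n ω))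

variable [MeasurableSpace H] [MeasurableSpace S] [MeasurableSpace A]

/-- The assumptions on a run, relative to the data `α, g, K, μ, β, m₄, Σ_zz, Σ_ξz, Σ_ξξ`. -/
structure Assumptions (R : Run Ω H S A) (Pr : Measure Ω) (p : SamplingParams S A)
    (α : ℝ) (g : H) (K : Kernel (S × A) S) (μ : S → A) (β m₄ : ℝ)
    (Szz Sxz Sxx : H →L[ℝ] H) : Prop where
  /- the quantities below are random variables, and the initial estimate is square integrable -/
  measurable_Q : ∀ n, Measurable (R.Q n)
  measurable_prev : ∀ n, Measurable (R.prev n)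
  measurable_state : ∀ n, Measurable (R.state n)
  measurable_xi : ∀ᶠ n in atTop, Measurable (R.xi Pr p n)
  init : ∫⁻ ω, ‖R.Q 0 ω‖ₑ ^ 2 ∂Pr < ∞
  /- `K` is the transition probability: the conditional law of `s_n` given `z_{n-1}` -/
  transition : ∀ᶠ n in atTop,
    Pr.map (fun ω => (R.prev n ω, R.state n ω)) = (Pr.map (R.prev n)).compProd K
  /- the policy is eventually fixed -/
  policy_eq : ∀ᶠ n in atTop, ∀ᵐ ω ∂Pr, R.policy n ω = μ
  /- contraction property of the classical Bellman maps -/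
  contraction : ∀ᶠ n in atTop, ∀ᵐ ω ∂Pr,
    IsContractionOn H (bellmanPolicy K (g : S × A → ℝ) α (R.policy n ω)) β
  /- `(z_{n-1}, ξ_n)` is independent of `Q_0, …, Q_n` -/
  independence : ∀ᶠ n in atTop,
    Indep (MeasurableSpace.comap (fun ω => (R.prev n ω, R.xi Pr p n ω)) inferInstance)
      (⨆ k ≤ n, MeasurableSpace.comap (R.Q k) inferInstance) Pr
  /- stationary fourth moment -/
  moment : ∀ᶠ n in atTop, ∫⁻ ω, ‖R.xi Pr p n ω‖ₑ ^ 4 ∂Pr = ENNReal.ofReal m₄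
  /- stationary covariance operators; recall that `prev (n + 1)` is `z_n` -/
  cov_zz : ∀ᶠ n in atTop, IsCrossCov Pr (fun ω => feature H (R.prev (n + 1) ω))
    (fun ω => feature H (R.prev (n + 1) ω)) Szz
  cov_xz : ∀ᶠ n in atTop, IsCrossCov Pr (fun ω => feature H (R.prev n ω)) (R.xi Pr p n) Sxz
  cov_xx : ∀ᶠ n in atTop, IsCrossCov Pr (R.xi Pr p n) (R.xi Pr p n) Sxx
  /- positive definiteness -/
  pos_curvature : ∀ᶠ n in atTop, ∀ᵐ ω ∂Pr,
    0 < sigmaMin (curvature α (R.condOp Pr n (R.policy n ω)) Szz Sxz Sxx)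
  pos_zz : 0 < sigmaMin Szz

end Probability

end Run

end BellmanRKHS

end

/-!
Two structural facts make the error recursion linear with constant coefficients.

* A bounded feature vector has a covariance operator of finite trace, so `σ_min(Σ_zz) > 0` forces
  `H` to be finite-dimensional (`finiteDimensional_of_sigmaMin_pos`). This provides the joint
  measurability that independence arguments need, and makes `Σ_zz` invertible.
* The linear part of a contractive Bellman map is a bounded operator `C` on `H`, namely
  `(C f)(z) = 𝔼[f(s', μ(s')) | z]` with `‖α C‖ ≤ β` (`exists_isTransitionOp`). Conditioning on
  `z_{n-1}` gives `Σ_{s'z} = Σ_zz C`, hence `Σ_{s'|z} = C` for all large `n` (`Run.condOp_eq`).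

Let `q` be the fixed point of the Bellman map of `μ`, so that `‖q‖ ≤ ‖g‖ / (1 - β)`, and put
`D = α C - 1`, `v_n = α ξ_n + D^* φ(z_{n-1})` and `e_n = Q_n - q`. As `D q = -g`, the gradient step
reads `e_{n+1} = e_n - η (⟪e_n, v_n⟫ + α ⟪q, ξ_n⟫) v_n` (`Run.update_sub_eq`). The curvature
operator is the covariance operator of `v_n` (`isCrossCov_curvature`), so with `l > 0` its minimum
spectral value, `𝔼⟪e, v_n⟫² ≥ l ‖e‖²` for each deterministic `e`. Expanding the square, the cross term is
absorbed by half of the decrease `-2 η ⟪e, v_n⟫²` at the cost of `η α² ⟪q, ξ_n⟫²`, and the terms of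
order `η²` are controlled by the fourth moment of `ξ_n` (`lintegral_step_le`). As `(z_{n-1}, ξ_n)`
is independent of `Q_n`, integrating over `e = e_n` gives
`𝔼‖e_{n+1}‖² ≤ (1 - η l / 2) 𝔼‖e_n‖² + O(η²) + O(η) 𝔼‖ξ_n‖²` for large `n`
(`Run.Assumptions.lintegral_succ_le`).

All `𝔼‖e_n‖²` are finite: the regularized inverse kernel matrix has entries bounded by `1 / σ'_N`,
and the number of samples at time `n` is bounded by a constant, so every single step is affine with
bounded coefficients (`Run.lintegral_Q_sq_ne_top`). The upper limit of such a recursion is the upper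
limit of its forcing term divided by `η l / 2` (`limsup_le_of_affine_recursion`). The bound follows
from `𝔼‖ξ_n‖² ≤ B_κ 𝔼‖Σ_{s'|z} - Σ̂_{s'|z}‖²` and
`‖Q_n - Q_*‖² ≤ 2 ‖Q_n - q‖² + 2 ‖q - Q_*‖²`.
-/

namespace BellmanRKHS

/-! ### Linear recursions in the extended nonnegative reals -/

lemma limsup_const_add_const_mul (b k : ℝ≥0∞) (hk : k ≠ ∞) (x : ℕ → ℝ≥0∞) :
    limsup (fun n => b + k * x n) atTop = b + k * limsup x atTop := by
  have hm : Monotone fun y : ℝ≥0∞ => b + k * y := fun _ _ h =>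
    add_le_add le_rfl (mul_le_mul_right h k)
  have hc : Continuous fun y : ℝ≥0∞ => b + k * y :=
    continuous_const.add (ENNReal.continuous_const_mul hk)
  exact (hm.map_limsup_of_continuousAt x hc.continuousAt).symm

/-- If `a` is finite and `a (n + 1) ≤ (1 - θ) a n + d n` for large `n`, then `limsup a` is at most
`(limsup d) / θ`. -/
lemma limsup_le_of_affine_recursion {θ : ℝ} (h0 : 0 < θ) (h1 : θ ≤ 1) {a d : ℕ → ℝ≥0∞}
    (ha : ∀ n, a n ≠ ∞)
    (h : ∀ᶠ n in atTop, a (n + 1) ≤ ENNReal.ofReal (1 - θ) * a n + d n) :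
    limsup a atTop ≤ ENNReal.ofReal θ⁻¹ * limsup d atTop := by
  have key : ∀ D : ℝ≥0∞, limsup d atTop < D → limsup a atTop ≤ ENNReal.ofReal θ⁻¹ * D := by
    intro D hD
    obtain ⟨N, hN⟩ := eventually_atTop.1 (h.and (eventually_lt_of_limsup_lt hD))
    -- `D / θ` is the fixed point of the affine map with constant forcing `D`
    have hfix : ENNReal.ofReal (1 - θ) * (ENNReal.ofReal θ⁻¹ * D) + D
        = ENNReal.ofReal θ⁻¹ * D := by
      conv_lhs => rw [← mul_assoc, ← ENNReal.ofReal_mul (by linarith)]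
      nth_rewrite 2 [← one_mul D]
      rw [← add_mul, ← ENNReal.ofReal_one, ← ENNReal.ofReal_add (by
        have := inv_pos.2 h0
        exact mul_nonneg (by linarith) this.le) zero_le_one]
      congr 2
      field_simp
      ring
    have hk : ∀ k, a (k + N) ≤ ENNReal.ofReal (1 - θ) ^ k * a N + ENNReal.ofReal θ⁻¹ * D := by
      intro k
      induction k with
      | zero => simp
      | succ k ih =>
        have h2 := hN (k + N) (by omega)
        calc a (k + 1 + N) = a (k + N + 1) := by congr 1; omega
          _ ≤ ENNReal.ofReal (1 - θ) * a (k + N) + d (k + N) := h2.1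
          _ ≤ ENNReal.ofReal (1 - θ)
                * (ENNReal.ofReal (1 - θ) ^ k * a N + ENNReal.ofReal θ⁻¹ * D) + D := by
              gcongr
              exact h2.2.le
          _ = ENNReal.ofReal (1 - θ) ^ (k + 1) * a N
                + (ENNReal.ofReal (1 - θ) * (ENNReal.ofReal θ⁻¹ * D) + D) := by ring
          _ = _ := by rw [hfix]
    have ht : Tendsto (fun k => ENNReal.ofReal (1 - θ) ^ k * a N + ENNReal.ofReal θ⁻¹ * D) atTop
        (nhds (0 * a N + ENNReal.ofReal θ⁻¹ * D)) := by
      refine Tendsto.add (ENNReal.Tendsto.mul_const ?_ (Or.inr (ha N))) tendsto_const_nhds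
      apply ENNReal.tendsto_pow_atTop_nhds_zero_of_lt_one
      rw [ENNReal.ofReal_lt_one]
      linarith
    rw [zero_mul, zero_add] at ht
    rw [← limsup_nat_add a N, ← ht.limsup_eq]
    exact limsup_le_limsup (Eventually.of_forall hk)
  by_cases htop : limsup d atTop = ∞
  · rw [htop, ENNReal.mul_top (by simpa using h0)]
    exact le_top
  · have ht : Tendsto (fun D : ℝ≥0∞ => ENNReal.ofReal θ⁻¹ * D) (nhdsWithin (limsup d atTop)
        (Set.Ioi (limsup d atTop))) (nhds (ENNReal.ofReal θ⁻¹ * limsup d atTop)) :=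
      ((ENNReal.continuous_const_mul ENNReal.ofReal_ne_top).tendsto _).mono_left nhdsWithin_le_nhds
    have : (nhdsWithin (limsup d atTop) (Set.Ioi (limsup d atTop))).NeBot :=
      nhdsGT_neBot_of_exists_gt ⟨∞, lt_top_iff_ne_top.2 htop⟩
    exact ge_of_tendsto ht (eventually_nhdsWithin_of_forall key)

/-! ### Positive operators and cross-covariances -/

section Operators

variable {H : Type*} [NormedAddCommGroup H] [InnerProductSpace ℝ H]

lemma sigmaMin_mul_norm_sq_le (C : H →L[ℝ] H) (h : H) : sigmaMin C * ‖h‖ ^ 2 ≤ ⟪h, C h⟫_ℝ := by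
  rcases eq_or_ne h 0 with rfl | hne
  · simp
  have hpos : 0 < ‖h‖ := norm_pos_iff.2 hne
  have hb : BddBelow (Set.range fun h : {h : H // ‖h‖ = 1} => ⟪(h : H), C (h : H)⟫_ℝ) := by
    refine ⟨-‖C‖, ?_⟩
    rintro _ ⟨⟨x, hx⟩, rfl⟩
    have h1 := (abs_le.1 (abs_real_inner_le_norm x (C x))).1
    have h2 := C.le_opNorm x
    rw [hx] at h1 h2
    dsimp only
    linarith
  have hu : ‖(‖h‖⁻¹ • h : H)‖ = 1 := by
    rw [norm_smul, norm_inv, norm_norm, inv_mul_cancel₀ hpos.ne']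
  have h1 : sigmaMin C ≤ ⟪‖h‖⁻¹ • h, C (‖h‖⁻¹ • h)⟫_ℝ := ciInf_le hb ⟨‖h‖⁻¹ • h, hu⟩
  rw [map_smul, real_inner_smul_left, real_inner_smul_right, ← mul_assoc, ← mul_inv,
    inv_mul_eq_div, le_div_iff₀ (by positivity)] at h1
  rwa [sq]

lemma isInvertible_of_sigmaMin_pos [FiniteDimensional ℝ H] {C : H →L[ℝ] H} (hC : 0 < sigmaMin C) :
    C.IsInvertible := by
  have hinj : Function.Injective (C : H →ₗ[ℝ] H) := by
    rw [← LinearMap.ker_eq_bot, LinearMap.ker_eq_bot']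
    intro h hh
    have h1 := sigmaMin_mul_norm_sq_le C h
    rw [show C h = 0 from hh, inner_zero_right] at h1
    have h2 : ‖h‖ ^ 2 ≤ 0 := by
      by_contra hcon
      push Not at hcon
      nlinarith
    simpa using le_antisymm h2 (by positivity)
  exact ⟨(LinearEquiv.ofInjectiveEndo (C : H →ₗ[ℝ] H) hinj).toContinuousLinearEquiv, by
    ext h; simp⟩

variable {Ω : Type*} [MeasurableSpace Ω]

lemma IsCrossCov.unique {Pr : Measure Ω} {X Y : Ω → H} {C C' : H →L[ℝ] H}
    (h : IsCrossCov Pr X Y C) (h' : IsCrossCov Pr X Y C') : C = C' := by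
  ext f
  refine ext_inner_right ℝ fun k => ?_
  rw [(h f k).2, (h' f k).2]

lemma IsCrossCov.crossCov_eq {Pr : Measure Ω} {X Y : Ω → H} {C : H →L[ℝ] H}
    (h : IsCrossCov Pr X Y C) : crossCov Pr X Y = C := by
  have hC : ∃ C : H →L[ℝ] H, IsCrossCov Pr X Y C := ⟨C, h⟩
  rw [crossCov, dif_pos hC]
  exact hC.choose_spec.unique h

lemma IsCrossCov.integral_sq {Pr : Measure Ω} {X : Ω → H} {C : H →L[ℝ] H}
    (h : IsCrossCov Pr X X C) (f : H) :
    Integrable (fun ω => ⟪X ω, f⟫_ℝ ^ 2) Pr ∧ ∫ ω, ⟪X ω, f⟫_ℝ ^ 2 ∂Pr = ⟪f, C f⟫_ℝ := by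
  simp only [sq]
  exact ⟨(h f f).1, by rw [← (h f f).2, real_inner_comm]⟩

/-- A bounded random vector has a covariance operator of finite trace, which can only be bounded
below by a positive constant when the space is finite-dimensional. -/
lemma finiteDimensional_of_sigmaMin_pos {Pr : Measure Ω} [IsProbabilityMeasure Pr] {X : Ω → H}
    {C : H →L[ℝ] H} (h : IsCrossCov Pr X X C) {B : ℝ} (hB : ∀ ω, ‖X ω‖ ^ 2 ≤ B)
    (hC : 0 < sigmaMin C) : FiniteDimensional ℝ H := by
  rw [FiniteDimensional, ← Module.rank_lt_aleph0_iff]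
  by_contra hcon
  push Not at hcon
  obtain ⟨n, hn⟩ := exists_nat_gt (B / sigmaMin C)
  obtain ⟨f, hf⟩ := exists_linearIndependent_of_le_rank (R := ℝ) (M := H) (n := n)
    (Cardinal.natCast_lt_aleph0.le.trans hcon)
  have ho := InnerProductSpace.gramSchmidtNormed_orthonormal hf
  set e := InnerProductSpace.gramSchmidtNormed ℝ f
  have hint : ∀ i, Integrable (fun ω => ⟪X ω, e i⟫_ℝ ^ 2) Pr := fun i => (h.integral_sq (e i)).1
  have h1 : ∫ ω, ∑ i, ⟪X ω, e i⟫_ℝ ^ 2 ∂Pr ≤ B := by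
    calc ∫ ω, ∑ i, ⟪X ω, e i⟫_ℝ ^ 2 ∂Pr ≤ ∫ _, B ∂Pr := by
          refine integral_mono (integrable_finsetSum _ fun i _ => hint i) (integrable_const _) ?_
          intro ω
          refine le_trans ?_ (hB ω)
          simpa [real_inner_comm] using ho.sum_inner_products_le (X ω) (s := Finset.univ)
      _ = B := by simp
  rw [integral_finsetSum _ fun i _ => hint i] at h1
  have h2 : ∀ i, sigmaMin C ≤ ∫ ω, ⟪X ω, e i⟫_ℝ ^ 2 ∂Pr := by
    intro i
    rw [(h.integral_sq (e i)).2]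
    simpa [ho.1 i] using sigmaMin_mul_norm_sq_le C (e i)
  have h3 := Finset.sum_le_sum fun i (_ : i ∈ Finset.univ) => h2 i
  rw [div_lt_iff₀ hC] at hn
  simp only [Finset.sum_const, Finset.card_univ, Fintype.card_fin, nsmul_eq_mul] at h3
  linarith

variable [CompleteSpace H]

/-- The curvature operator is the covariance operator of `α X + (α C - 1)^* Z`, where `Z` and `X`
have covariance operators `Σ_zz`, `Σ_xx` and cross-covariance `Σ_xz`. -/
lemma isCrossCov_curvature {Pr : Measure Ω} {X Z : Ω → H} {α : ℝ} {C Szz Sxz Sxx : H →L[ℝ] H}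
    (hzz : IsCrossCov Pr Z Z Szz) (hxz : IsCrossCov Pr Z X Sxz) (hxx : IsCrossCov Pr X X Sxx) :
    IsCrossCov Pr
      (fun ω => α • X ω + (α • C - .id ℝ H).adjoint (Z ω))
      (fun ω => α • X ω + (α • C - .id ℝ H).adjoint (Z ω))
      (curvature α C Szz Sxz Sxx) := by
  intro f h
  set D := α • C - .id ℝ H with hD
  have hexp : (fun ω => ⟪α • X ω + D.adjoint (Z ω), f⟫_ℝ * ⟪α • X ω + D.adjoint (Z ω), h⟫_ℝ)
      = fun ω => ⟪Z ω, D f⟫_ℝ * ⟪Z ω, D h⟫_ℝ + α ^ 2 * (⟪X ω, f⟫_ℝ * ⟪X ω, h⟫_ℝ)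
        + α * (⟪Z ω, D f⟫_ℝ * ⟪X ω, h⟫_ℝ) + α * (⟪Z ω, D h⟫_ℝ * ⟪X ω, f⟫_ℝ) := by
    funext ω
    simp only [inner_add_left, real_inner_smul_left, ContinuousLinearMap.adjoint_inner_left]
    ring
  have i1 := (hzz (D f) (D h)).1
  have i2 := (hxx f h).1.const_mul (α ^ 2)
  have i3 := (hxz (D f) h).1.const_mul α
  have i4 := (hxz (D h) f).1.const_mul α
  rw [hexp]
  refine ⟨((i1.add i2).add i3).add i4, ?_⟩
  rw [integral_add (by exact (i1.add i2).add i3) i4, integral_add (by exact i1.add i2) i3,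
    integral_add i1 i2, integral_const_mul, integral_const_mul, integral_const_mul,
    ← (hzz _ _).2, ← (hxx _ _).2, ← (hxz _ _).2, ← (hxz _ _).2, curvature, ← hD]
  simp only [add_apply, smul_apply,
    ContinuousLinearMap.comp_apply, inner_add_left, real_inner_smul_left,
    ContinuousLinearMap.adjoint_inner_left]
  rw [real_inner_comm (Sxz (D h)) f]

end Operators

/-! ### Features -/

section Features

variable {H X : Type*} [NormedAddCommGroup H] [InnerProductSpace ℝ H] [CompleteSpace H]
  [RKHS ℝ H X ℝ]

lemma inner_feature (f : H) (x : X) : ⟪f, feature H x⟫_ℝ = f x := by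
  simp [feature]

lemma norm_feature_le {B : ℝ} (hκ : ∀ x : X, ⟪feature H x, feature H x⟫_ℝ ≤ B) (x : X) :
    ‖feature H x‖ ≤ √B :=
  Real.le_sqrt_of_sq_le (by rw [← real_inner_self_eq_norm_sq]; exact hκ x)

lemma abs_apply_le {B : ℝ} (hκ : ∀ x : X, ⟪feature H x, feature H x⟫_ℝ ≤ B) (f : H) (x : X) :
    |f x| ≤ ‖f‖ * √B := by
  rw [← inner_feature]
  exact (abs_real_inner_le_norm _ _).trans (by gcongr; exact norm_feature_le hκ x)

end Features

/-! ### The sampled operator and its loss -/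

/-- The entries of a regularized inverse `(a G + r)⁻¹` of a positive semidefinite matrix are at most
`1 / r`, whatever the size of the matrix. -/
lemma abs_inv_entry_le {n : Type*} [Fintype n] [DecidableEq n] {G : Matrix n n ℝ}
    (hG : G.PosSemidef) {a r : ℝ} (ha : 0 ≤ a) (hr : 0 < r) (i j : n) :
    |(a • G + r • (1 : Matrix n n ℝ))⁻¹ i j| ≤ r⁻¹ := by
  set M := a • G + r • (1 : Matrix n n ℝ) with hM
  have hpd : M.PosDef := Matrix.PosDef.posSemidef_add (hG.smul ha) (Matrix.PosDef.one.smul hr)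
  have hdet : IsUnit M.det := (Matrix.isUnit_iff_isUnit_det M).1 hpd.isUnit
  -- the column `x` of the inverse satisfies `r ‖x‖² ≤ ⟪x, M x⟫ = x j`
  set x : n → ℝ := fun k => M⁻¹ k j with hx
  have hMx : M.mulVec x = Pi.single j 1 := by
    have h1 : x = M⁻¹.mulVec (Pi.single j 1) := by
      ext k
      simp [hx]
    rw [h1, Matrix.mulVec_mulVec, Matrix.mul_nonsing_inv _ hdet, Matrix.one_mulVec]
  have h1 : x ⬝ᵥ M.mulVec x = x j := by rw [hMx]; simp
  have h2 : x ⬝ᵥ M.mulVec x = a * (x ⬝ᵥ G.mulVec x) + r * (x ⬝ᵥ x) := by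
    rw [hM, Matrix.add_mulVec, Matrix.smul_mulVec, Matrix.smul_mulVec, Matrix.one_mulVec,
      dotProduct_add, dotProduct_smul, dotProduct_smul, smul_eq_mul, smul_eq_mul]
  have h3 : 0 ≤ x ⬝ᵥ G.mulVec x := by
    simpa using hG.dotProduct_mulVec_nonneg x
  have h4 : ∀ k, x k ^ 2 ≤ x ⬝ᵥ x := by
    intro k
    rw [sq]
    exact Finset.single_le_sum (f := fun k => x k * x k) (fun k _ => mul_self_nonneg _)
      (Finset.mem_univ k)
  have h5 : ∀ k, r * x k ^ 2 ≤ x j := by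
    intro k
    have := mul_le_mul_of_nonneg_left (h4 k) hr.le
    have := mul_nonneg ha h3
    linarith
  have h6 : x j ≤ r⁻¹ := by
    rw [← one_div, le_div_iff₀ hr]
    nlinarith [h5 j, sq_nonneg (r * x j - 1)]
  have h7 : x i ^ 2 ≤ r⁻¹ ^ 2 := by
    have h8 : r * x i ^ 2 ≤ r⁻¹ := (h5 i).trans h6
    calc x i ^ 2 = r⁻¹ * (r * x i ^ 2) := by field_simp
      _ ≤ r⁻¹ * r⁻¹ := by gcongr
      _ = r⁻¹ ^ 2 := by ring
  exact abs_le_of_sq_le_sq h7 (by positivity)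

section Sampled

variable {H S A : Type*} [NormedAddCommGroup H] [InnerProductSpace ℝ H] [CompleteSpace H]
  [RKHS ℝ H (S × A) ℝ]

lemma gradient_loss (g : H) (α : ℝ) (reg : ℕ → ℝ) (ν : S → A) (T : Finset (S × A × S))
    (z : S × A) (Q : H) :
    gradient (loss g α reg ν T z) Q =
      ⟪g + α • condEstimate reg ν T Q - Q, feature H z⟫_ℝ •
        (α • (condEstimate reg ν T).adjoint (feature H z) - feature H z) := by
  apply HasGradientAt.gradient
  rw [hasGradientAt_iff_hasFDerivAt]
  set C : H →L[ℝ] H := condEstimate reg ν T with hC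
  have h1 : HasFDerivAt (fun Q : H => g + α • C Q - Q) (α • C - .id ℝ H) Q :=
    ((C.hasFDerivAt.const_smul α).const_add g).sub (hasFDerivAt_id Q)
  have h2 : HasFDerivAt (fun Q : H => ⟪feature H z, g + α • C Q - Q⟫_ℝ)
      ((innerSL ℝ (feature H z)) ∘L (α • C - .id ℝ H)) Q :=
    (innerSL ℝ (feature H z)).hasFDerivAt.comp Q h1
  have h3 := (h2.pow 2).const_mul (1 / 2 : ℝ)
  have h4 : loss g α reg ν T z = fun Q => (1 / 2 : ℝ) * ⟪feature H z, g + α • C Q - Q⟫_ℝ ^ 2 := by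
    funext Q
    rw [loss, sampledBellman, real_inner_comm]
  rw [h4]
  refine h3.congr_fderiv ?_
  ext h
  simp [inner_sub_left, inner_sub_right,
    ContinuousLinearMap.adjoint_inner_left, real_inner_comm]
  ring

lemma norm_condEstimate_le {B : ℝ} (hκ : ∀ z : S × A, ⟪feature H z, feature H z⟫_ℝ ≤ B)
    (reg : ℕ → ℝ) (ν : S → A) (T : Finset (S × A × S)) (hr : 0 < reg T.card) :
    ‖(condEstimate reg ν T : H →L[ℝ] H)‖ ≤
      (T.card : ℝ)⁻¹ * (T.card * (T.card * ((reg T.card)⁻¹ * (√B * √B)))) := by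
  classical
  have hG : (gram H T).PosSemidef :=
    Matrix.posSemidef_gram ℝ fun i : T => feature H (i.1.1, i.1.2.1)
  rw [condEstimate, norm_smul, norm_inv, Real.norm_natCast]
  refine mul_le_mul_of_nonneg_left ?_ (by positivity)
  have hT : (T.card : ℝ) = ((Finset.univ : Finset T).card : ℝ) := by simp
  rw [hT, ← nsmul_eq_mul]
  refine (norm_sum_le_of_le _ fun i _ => ?_).trans_eq (Finset.sum_const _)
  rw [← nsmul_eq_mul]
  refine (norm_sum_le_of_le _ fun j _ => ?_).trans_eq (Finset.sum_const _)
  rw [norm_smul, InnerProductSpace.norm_rankOne]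
  refine mul_le_mul ?_ (mul_le_mul (norm_feature_le hκ _) (norm_feature_le hκ _) (norm_nonneg _)
    (Real.sqrt_nonneg _)) (by positivity) (by simpa using hr.le)
  rw [← hT, Real.norm_eq_abs]
  convert! abs_inv_entry_le hG (a := (T.card : ℝ)⁻¹) (by positivity) hr i j

end Sampled

/-! ### The transition operator of a policy -/

section Transition

variable {H S A : Type*} [MeasurableSpace S] [MeasurableSpace A]
  [NormedAddCommGroup H] [InnerProductSpace ℝ H] [CompleteSpace H]
  [RKHS ℝ H (S × A) ℝ]

/-- `C` is the transition operator of the policy `ν` on `H`: `(C f)(z) = 𝔼[f(s', ν(s')) | z]`. -/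
def IsTransitionOp (K : Kernel (S × A) S) (ν : S → A) (C : H →L[ℝ] H) : Prop :=
  ∀ (f : H) (z : S × A), C f z = ∫ s', f (s', ν s') ∂(K z)

omit [CompleteSpace H] in
lemma IsTransitionOp.unique {K : Kernel (S × A) S} {ν : S → A} {C C' : H →L[ℝ] H}
    (h : IsTransitionOp K ν C) (h' : IsTransitionOp K ν C') : C = C' :=
  ContinuousLinearMap.ext fun f => RKHS.ext fun z => by rw [h f z, h' f z]

omit [CompleteSpace H] in
lemma IsTransitionOp.eq_of_isFixedPointIn {K : Kernel (S × A) S} {ν : S → A} {C : H →L[ℝ] H}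
    (h : IsTransitionOp K ν C) {g : H} {α : ℝ} {Q : H}
    (hQ : IsFixedPointIn (bellmanPolicy K (g : S × A → ℝ) α ν) Q) : g + α • C Q = Q := by
  refine RKHS.ext fun z => ?_
  rw [RKHS.coe_add, RKHS.coe_smul, Pi.add_apply, Pi.smul_apply, h Q z, smul_eq_mul]
  exact congrFun hQ z

variable [MeasurableSpace H] [BorelSpace H]

lemma measurable_apply (hφ : Measurable (feature H : S × A → H)) (f : H) :
    Measurable (f : S × A → ℝ) := by
  have h : (f : S × A → ℝ) = fun z => ⟪f, feature H z⟫_ℝ := by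
    funext z
    rw [inner_feature]
  rw [h]
  exact (continuous_const.inner continuous_id).measurable.comp hφ

lemma integrable_apply_policy (hφ : Measurable (feature H : S × A → H)) {B : ℝ}
    (hκ : ∀ z : S × A, ⟪feature H z, feature H z⟫_ℝ ≤ B) {ν : S → A} (hν : Measurable ν)
    (m : Measure S) [IsFiniteMeasure m] (f : H) : Integrable (fun s => f (s, ν s)) m :=
  .of_bound ((measurable_apply hφ f).comp (measurable_id.prodMk hν)).aestronglyMeasurable
    (‖f‖ * √B) (Eventually.of_forall fun s => abs_apply_le hκ f (s, ν s))

/-- If the Bellman map of a policy is a contraction of `H`, then its linear part is a bounded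
operator on `H` of norm at most the contraction modulus. -/
lemma exists_isTransitionOp (hφ : Measurable (feature H : S × A → H)) {B : ℝ}
    (hκ : ∀ z : S × A, ⟪feature H z, feature H z⟫_ℝ ≤ B) {ν : S → A} (hν : Measurable ν)
    (K : Kernel (S × A) S) [IsMarkovKernel K] {α β : ℝ} (hα : 0 < α) (g : H)
    (hT : IsContractionOn H (bellmanPolicy K (g : S × A → ℝ) α ν) β) :
    ∃ C : H →L[ℝ] H, IsTransitionOp K ν C ∧ ∀ f, ‖α • C f‖ ≤ β * ‖f‖ := by
  obtain ⟨F, hF, hc⟩ := hT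
  have hval : ∀ f z, (α⁻¹ • (F f - g)) z = ∫ s', f (s', ν s') ∂(K z) := by
    intro f z
    rw [RKHS.coe_smul, RKHS.coe_sub, hF f, Pi.smul_apply, Pi.sub_apply, smul_eq_mul,
      bellmanPolicy, add_sub_cancel_left, inv_mul_cancel_left₀ hα.ne']
  have hint := fun (z : S × A) (f : H) => integrable_apply_policy hφ hκ hν (K z) f
  have hF0 : F 0 = g := by
    refine RKHS.ext fun z => ?_
    rw [hF 0]
    simp [bellmanPolicy]
  have hb : ∀ f, ‖F f - g‖ ≤ β * ‖f‖ := by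
    intro f
    simpa [hF0] using hc f 0
  let L : H →ₗ[ℝ] H :=
    { toFun := fun f => α⁻¹ • (F f - g)
      map_add' := fun f f' => RKHS.ext fun z => by
        rw [RKHS.coe_add, Pi.add_apply, hval, hval, hval, ← integral_add (hint z f) (hint z f')]
        simp
      map_smul' := fun c f => RKHS.ext fun z => by
        rw [hval (c • f) z, RingHom.id_apply, RKHS.coe_smul (α⁻¹ • (F f - g)) c,
          Pi.smul_apply, hval, smul_eq_mul, ← integral_const_mul]
        simp }
  refine ⟨L.mkContinuous (α⁻¹ * β) fun f => ?_, fun f z => hval f z, fun f => ?_⟩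
  · change ‖α⁻¹ • (F f - g)‖ ≤ _
    rw [norm_smul, Real.norm_of_nonneg (by positivity), mul_assoc]
    gcongr
    exact hb f
  · change ‖α • α⁻¹ • (F f - g)‖ ≤ _
    rw [smul_inv_smul₀ hα.ne']
    exact hb f

end Transition

/-! ### One stochastic gradient step from a deterministic error -/

section Step

variable {H : Type*} [NormedAddCommGroup H] [InnerProductSpace ℝ H]

omit [InnerProductSpace ℝ H] in
lemma enorm_sq_eq_ofReal (x : H) : ‖x‖ₑ ^ 2 = ENNReal.ofReal (‖x‖ ^ 2) := by
  rw [← ofReal_norm, ENNReal.ofReal_pow (norm_nonneg x)]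

omit [InnerProductSpace ℝ H] in
lemma enorm_add_sq_le (x y : H) : ‖x + y‖ₑ ^ 2 ≤ 2 * ‖x‖ₑ ^ 2 + 2 * ‖y‖ₑ ^ 2 := by
  have h2 : (2 : ℝ≥0∞) = ENNReal.ofReal 2 := by simp
  rw [enorm_sq_eq_ofReal, enorm_sq_eq_ofReal, enorm_sq_eq_ofReal, h2,
    ← ENNReal.ofReal_mul zero_le_two, ← ENNReal.ofReal_mul zero_le_two,
    ← ENNReal.ofReal_add (by positivity) (by positivity)]
  apply ENNReal.ofReal_le_ofReal
  calc ‖x + y‖ ^ 2 ≤ (‖x‖ + ‖y‖) ^ 2 := by gcongr; exact norm_add_le x y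
    _ ≤ 2 * (‖x‖ ^ 2 + ‖y‖ ^ 2) := add_sq_le
    _ = _ := by ring

/-- Pointwise expansion of the squared error after one step with direction `v = α x + y`: half of
the decrease `2 η ⟪v, e⟫²` absorbs the cross term with `⟪q, x⟫`, and
`‖v‖⁴ ≤ 8 α⁴ ‖x‖⁴ + 128 B²` bounds what is of order `η²`. -/
lemma norm_sq_step_le {e q x y : H} {α η G B : ℝ} (hη : 0 < η) (hq : ‖q‖ ≤ G)
    (hy : ‖y‖ ^ 2 ≤ 4 * B) :
    ‖e - (η * (⟪α • x + y, e⟫_ℝ + α * ⟪q, x⟫_ℝ)) • (α • x + y)‖ ^ 2 ≤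
      ‖e‖ ^ 2 - η * ⟪α • x + y, e⟫_ℝ ^ 2
        + 2 * η ^ 2 * ‖e‖ ^ 2 * (8 * α ^ 4 * ‖x‖ ^ 4 + 128 * B ^ 2)
        + η ^ 2 * α ^ 2 * G ^ 2 * (‖x‖ ^ 4 + (8 * α ^ 4 * ‖x‖ ^ 4 + 128 * B ^ 2))
        + η * α ^ 2 * G ^ 2 * ‖x‖ ^ 2 := by
  set v := α • x + y with hv
  set t := ⟪v, e⟫_ℝ with ht
  set c := ⟪q, x⟫_ℝ with hc
  have hexp : ‖e - (η * (t + α * c)) • v‖ ^ 2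
      = ‖e‖ ^ 2 - 2 * (η * (t + α * c)) * t + (η * (t + α * c)) ^ 2 * ‖v‖ ^ 2 := by
    rw [norm_sub_sq_real, real_inner_smul_right, real_inner_comm, ← ht, norm_smul, mul_pow,
      Real.norm_eq_abs, sq_abs]
    ring
  have ht2 : t ^ 2 ≤ ‖v‖ ^ 2 * ‖e‖ ^ 2 := by
    rw [← mul_pow, ← sq_abs t]
    gcongr
    exact abs_real_inner_le_norm v e
  have hc2 : c ^ 2 ≤ G ^ 2 * ‖x‖ ^ 2 := by
    rw [← mul_pow, ← sq_abs c]
    gcongr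
    exact (abs_real_inner_le_norm q x).trans (by gcongr)
  have hv2 : ‖v‖ ^ 2 ≤ 2 * (α ^ 2 * ‖x‖ ^ 2) + 2 * ‖y‖ ^ 2 := by
    have h1 : ‖v‖ ≤ |α| * ‖x‖ + ‖y‖ := by
      rw [hv, ← Real.norm_eq_abs, ← norm_smul]
      exact norm_add_le _ _
    calc ‖v‖ ^ 2 ≤ (|α| * ‖x‖ + ‖y‖) ^ 2 := by gcongr
      _ ≤ 2 * ((|α| * ‖x‖) ^ 2 + ‖y‖ ^ 2) := add_sq_le
      _ = _ := by rw [mul_pow, sq_abs]; ring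
  have hv4 : ‖v‖ ^ 4 ≤ 8 * α ^ 4 * ‖x‖ ^ 4 + 128 * B ^ 2 := by
    calc ‖v‖ ^ 4 = (‖v‖ ^ 2) ^ 2 := by ring
      _ ≤ (2 * (α ^ 2 * ‖x‖ ^ 2) + 2 * (4 * B)) ^ 2 := by
          gcongr
          linarith
      _ ≤ 2 * ((2 * (α ^ 2 * ‖x‖ ^ 2)) ^ 2 + (2 * (4 * B)) ^ 2) := add_sq_le
      _ = _ := by ring
  have h1 : -(2 * (t + α * c) * t) ≤ -t ^ 2 + α ^ 2 * c ^ 2 := by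
    nlinarith [sq_nonneg (t + α * c)]
  have h2 : (t + α * c) ^ 2 * ‖v‖ ^ 2 ≤
      2 * ‖e‖ ^ 2 * ‖v‖ ^ 4 + α ^ 2 * G ^ 2 * (‖x‖ ^ 4 + ‖v‖ ^ 4) := by
    calc (t + α * c) ^ 2 * ‖v‖ ^ 2 ≤ 2 * (t ^ 2 + (α * c) ^ 2) * ‖v‖ ^ 2 := by
          gcongr
          exact add_sq_le
      _ = 2 * t ^ 2 * ‖v‖ ^ 2 + 2 * α ^ 2 * c ^ 2 * ‖v‖ ^ 2 := by ring
      _ ≤ 2 * (‖v‖ ^ 2 * ‖e‖ ^ 2) * ‖v‖ ^ 2 + 2 * α ^ 2 * (G ^ 2 * ‖x‖ ^ 2) * ‖v‖ ^ 2 := by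
          gcongr
      _ = 2 * ‖e‖ ^ 2 * ‖v‖ ^ 4 + α ^ 2 * G ^ 2 * (2 * ‖x‖ ^ 2 * ‖v‖ ^ 2) := by ring
      _ ≤ _ := by
          gcongr
          nlinarith [sq_nonneg (‖x‖ ^ 2 - ‖v‖ ^ 2)]
  have h3 : (t + α * c) ^ 2 * ‖v‖ ^ 2 ≤
      2 * ‖e‖ ^ 2 * (8 * α ^ 4 * ‖x‖ ^ 4 + 128 * B ^ 2)
        + α ^ 2 * G ^ 2 * (‖x‖ ^ 4 + (8 * α ^ 4 * ‖x‖ ^ 4 + 128 * B ^ 2)) :=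
    h2.trans (by gcongr)
  have h4 : η * (-(2 * (t + α * c) * t)) ≤ η * (-t ^ 2 + α ^ 2 * (G ^ 2 * ‖x‖ ^ 2)) := by
    gcongr
    exact h1.trans (by gcongr)
  have h5 := mul_le_mul_of_nonneg_left h3 (sq_nonneg η)
  rw [hexp]
  linarith

variable [MeasurableSpace H] [BorelSpace H] {Ω : Type*} [MeasurableSpace Ω]

/-- One step of the iteration contracts the mean square of a deterministic error `e`, up to an
additive noise term. The curvature `l` controls the decrease, which absorbs the second-order term
`2 η² M ‖e‖²` for `η ≤ l / (4 M)`. -/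
lemma lintegral_step_le {Pr : Measure Ω} [IsProbabilityMeasure Pr] {X Y : Ω → H}
    (hX : Measurable X) {α η G B m l : ℝ} (hm : 0 ≤ m)
    (hX4 : ∫⁻ ω, ‖X ω‖ₑ ^ 4 ∂Pr = ENNReal.ofReal m) (hY : ∀ ω, ‖Y ω‖ ^ 2 ≤ 4 * B)
    {q : H} (hq : ‖q‖ ≤ G) (e : H)
    (hint : Integrable (fun ω => ⟪α • X ω + Y ω, e⟫_ℝ ^ 2) Pr)
    (hl : l * ‖e‖ ^ 2 ≤ ∫ ω, ⟪α • X ω + Y ω, e⟫_ℝ ^ 2 ∂Pr)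
    (hη : 0 < η) (hηM : η * (4 * (8 * α ^ 4 * m + 128 * B ^ 2)) ≤ l) (hηl : η * l ≤ 2) :
    ∫⁻ ω, ‖e - (η * (⟪α • X ω + Y ω, e⟫_ℝ + α * ⟪q, X ω⟫_ℝ)) • (α • X ω + Y ω)‖ₑ ^ 2 ∂Pr ≤
      ENNReal.ofReal (1 - η * l / 2) * ‖e‖ₑ ^ 2
        + (ENNReal.ofReal (η ^ 2 * (α ^ 2 * G ^ 2 * (m + (8 * α ^ 4 * m + 128 * B ^ 2))))
          + ENNReal.ofReal (η * (α ^ 2 * G ^ 2)) * ∫⁻ ω, ‖X ω‖ₑ ^ 2 ∂Pr) := by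
  have h4eq : ∀ ω, ‖X ω‖ₑ ^ 4 = ENNReal.ofReal (‖X ω‖ ^ 4) := fun ω => by
    rw [← ofReal_norm, ENNReal.ofReal_pow (norm_nonneg _)]
  have i4 : Integrable (fun ω => ‖X ω‖ ^ 4) Pr := by
    refine ⟨(hX.norm.pow_const 4).aestronglyMeasurable, ?_⟩
    rw [hasFiniteIntegral_iff_ofReal (Eventually.of_forall fun ω => by positivity)]
    simp_rw [← h4eq, hX4]
    exact ENNReal.ofReal_lt_top
  have e4 : ∫ ω, ‖X ω‖ ^ 4 ∂Pr = m := by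
    rw [integral_eq_lintegral_of_nonneg_ae (Eventually.of_forall fun ω => by positivity)
      i4.aestronglyMeasurable]
    simp_rw [← h4eq, hX4]
    exact ENNReal.toReal_ofReal hm
  have i2 : Integrable (fun ω => ‖X ω‖ ^ 2) Pr := by
    refine ((integrable_const (1 : ℝ)).add i4).mono'
      (hX.norm.pow_const 2).aestronglyMeasurable (Eventually.of_forall fun ω => ?_)
    rw [Real.norm_of_nonneg (by positivity), Pi.add_apply]
    nlinarith [sq_nonneg (‖X ω‖ ^ 2 - 1), sq_nonneg (‖X ω‖ ^ 2)]
  set M := 8 * α ^ 4 * m + 128 * B ^ 2 with hM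
  have iM : Integrable (fun ω => 8 * α ^ 4 * ‖X ω‖ ^ 4 + 128 * B ^ 2) Pr :=
    (i4.const_mul _).add (integrable_const _)
  have eM : ∫ ω, (8 * α ^ 4 * ‖X ω‖ ^ 4 + 128 * B ^ 2) ∂Pr = M := by
    rw [integral_add (i4.const_mul _) (integrable_const _), integral_const_mul, e4]
    simp [hM]
  set u : Ω → ℝ := fun ω => ‖e‖ ^ 2 - η * ⟪α • X ω + Y ω, e⟫_ℝ ^ 2
        + 2 * η ^ 2 * ‖e‖ ^ 2 * (8 * α ^ 4 * ‖X ω‖ ^ 4 + 128 * B ^ 2)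
        + η ^ 2 * α ^ 2 * G ^ 2 * (‖X ω‖ ^ 4 + (8 * α ^ 4 * ‖X ω‖ ^ 4 + 128 * B ^ 2))
        + η * α ^ 2 * G ^ 2 * ‖X ω‖ ^ 2 with hu
  have j1 : Integrable (fun ω => ‖e‖ ^ 2 - η * ⟪α • X ω + Y ω, e⟫_ℝ ^ 2) Pr :=
    (integrable_const _).sub (hint.const_mul η)
  have j2 := iM.const_mul (2 * η ^ 2 * ‖e‖ ^ 2)
  have j3 := (i4.add iM).const_mul (η ^ 2 * α ^ 2 * G ^ 2)
  have j4 := i2.const_mul (η * α ^ 2 * G ^ 2)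
  have iu : Integrable u Pr := ((j1.add j2).add j3).add j4
  have eu : ∫ ω, u ω ∂Pr = ‖e‖ ^ 2 - η * ∫ ω, ⟪α • X ω + Y ω, e⟫_ℝ ^ 2 ∂Pr
      + 2 * η ^ 2 * ‖e‖ ^ 2 * M + η ^ 2 * α ^ 2 * G ^ 2 * (m + M)
      + η * α ^ 2 * G ^ 2 * ∫ ω, ‖X ω‖ ^ 2 ∂Pr := by
    rw [hu, integral_add (by exact (j1.add j2).add j3) j4, integral_add (by exact j1.add j2)
      (by exact j3), integral_add j1 j2, integral_sub (integrable_const _) (hint.const_mul η),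
      integral_const_mul, integral_const_mul, integral_const_mul, integral_const_mul,
      integral_add i4 iM, e4, eM]
    simp
  have hpt : ∀ ω, ‖e - (η * (⟪α • X ω + Y ω, e⟫_ℝ + α * ⟪q, X ω⟫_ℝ)) • (α • X ω + Y ω)‖ ^ 2
      ≤ u ω := fun ω => norm_sq_step_le hη hq (hY ω)
  have hx2 : ∫⁻ ω, ‖X ω‖ₑ ^ 2 ∂Pr = ENNReal.ofReal (∫ ω, ‖X ω‖ ^ 2 ∂Pr) := by
    rw [ofReal_integral_eq_lintegral_ofReal i2 (Eventually.of_forall fun ω => by positivity)]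
    simp_rw [enorm_sq_eq_ofReal]
  have hx0 : 0 ≤ ∫ ω, ‖X ω‖ ^ 2 ∂Pr := integral_nonneg fun ω => by positivity
  calc ∫⁻ ω, ‖e - (η * (⟪α • X ω + Y ω, e⟫_ℝ + α * ⟪q, X ω⟫_ℝ)) • (α • X ω + Y ω)‖ₑ ^ 2 ∂Pr
      ≤ ∫⁻ ω, ENNReal.ofReal (u ω) ∂Pr := by
        refine lintegral_mono fun ω => ?_
        rw [enorm_sq_eq_ofReal]
        exact ENNReal.ofReal_le_ofReal (hpt ω)
    _ = ENNReal.ofReal (∫ ω, u ω ∂Pr) :=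
        (ofReal_integral_eq_lintegral_ofReal iu
          (Eventually.of_forall fun ω => (sq_nonneg _).trans (hpt ω))).symm
    _ ≤ ENNReal.ofReal ((1 - η * l / 2) * ‖e‖ ^ 2
          + (η ^ 2 * (α ^ 2 * G ^ 2 * (m + M)) + η * (α ^ 2 * G ^ 2) * ∫ ω, ‖X ω‖ ^ 2 ∂Pr)) := by
        apply ENNReal.ofReal_le_ofReal
        rw [eu]
        have h1 := mul_le_mul_of_nonneg_left hl hη.le
        have h2 := mul_le_mul_of_nonneg_left hηM (show 0 ≤ η * ‖e‖ ^ 2 / 2 by positivity)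
        linarith
    _ = _ := by
        have hM0 : 0 ≤ M := by positivity
        rw [ENNReal.ofReal_add (mul_nonneg (by linarith) (by positivity)) (by positivity),
          ENNReal.ofReal_add (by positivity) (by positivity), ENNReal.ofReal_mul (by linarith),
          ENNReal.ofReal_mul (p := η * (α ^ 2 * G ^ 2)) (by positivity), enorm_sq_eq_ofReal, hx2]

end Step

/-! ### Boundedness and error equation of a run -/

namespace Run

variable {Ω H S A : Type*}

lemma card_buffer_le [Fintype A] [NormedAddCommGroup H] [InnerProductSpace ℝ H] [CompleteSpace H]
    [RKHS ℝ H (S × A) ℝ] {R : Run Ω H S A} {p : SamplingParams S A} {g : H} {α η : ℝ}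
    (hR : R.IsRun p g α η) (n : ℕ) (ω : Ω) :
    (R.buffer n ω).card ≤ p.buffer₀.card + n * (1 + Fintype.card A) := by
  classical
  induction n with
  | zero => simp [hR.buffer_zero]
  | succ n ih =>
    rw [hR.buffer_succ]
    split_ifs with h
    · refine (Finset.card_union_le _ _).trans ?_
      have h1 := Finset.card_union_le (R.buffer n ω)
        {((R.prev n ω).1, (R.prev n ω).2, R.state n ω)}
      have h2 := Finset.card_image_le (s := (Finset.univ : Finset A))
        (f := fun a => ((R.prev n ω).1, a, R.succ n ω a))
      rw [Finset.card_singleton] at h1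
      rw [Finset.card_univ] at h2
      have h3 : (n + 1) * (1 + Fintype.card A)
        = n * (1 + Fintype.card A) + (1 + Fintype.card A) := by ring
      rw [h3]
      convert! add_le_add (h1.trans (add_le_add_left ih 1)) h2 using 1
      ring
    · refine ih.trans ?_
      gcongr
      omega

lemma card_samples_mem [Fintype A] [NormedAddCommGroup H] [InnerProductSpace ℝ H]
    [CompleteSpace H] [RKHS ℝ H (S × A) ℝ] {R : Run Ω H S A} {p : SamplingParams S A} {g : H}
    {α η : ℝ} (hR : R.IsRun p g α η) (n : ℕ) (ω : Ω) :
    (R.samples p n ω).card ∈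
      Finset.Icc 1 (p.buffer₀.card + (n + 1) * (1 + Fintype.card A) + 1) := by
  classical
  rw [Finset.mem_Icc]
  constructor
  · exact Finset.card_pos.2 ⟨_, Finset.mem_insert_self _ _⟩
  · refine (Finset.card_insert_le _ _).trans ?_
    gcongr
    exact (Finset.card_filter_le _ _).trans (card_buffer_le hR (n + 1) ω)

section

variable [NormedAddCommGroup H] [InnerProductSpace ℝ H] [CompleteSpace H] [RKHS ℝ H (S × A) ℝ]
  {R : Run Ω H S A} {p : SamplingParams S A} {g : H} {α η B : ℝ}

/-- At every single time the sampled operator is bounded uniformly over all realizations, because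
the number of samples takes finitely many values. -/
lemma exists_norm_condOpEst_le [Fintype A] (hR : R.IsRun p g α η)
    (hκ : ∀ z : S × A, ⟪feature H z, feature H z⟫_ℝ ≤ B) (n : ℕ) :
    ∃ c, ∀ ω, ‖R.condOpEst p n ω‖ ≤ c := by
  refine ⟨∑ N ∈ Finset.Icc 1 (p.buffer₀.card + (n + 1) * (1 + Fintype.card A) + 1),
    (N : ℝ)⁻¹ * (N * (N * ((p.reg N)⁻¹ * (√B * √B)))), fun ω => ?_⟩
  have hmem := card_samples_mem hR n ω
  refine (norm_condEstimate_le hκ p.reg _ _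
    (p.reg_pos _ (Finset.mem_Icc.1 hmem).1)).trans ?_
  refine Finset.single_le_sum (f := fun N : ℕ =>
    (N : ℝ)⁻¹ * (N * (N * ((p.reg N)⁻¹ * (√B * √B))))) (fun N hN => ?_) hmem
  have := p.reg_pos N (Finset.mem_Icc.1 hN).1
  positivity

lemma update_eq [Fintype A] (hR : R.IsRun p g α η) (n : ℕ) (ω : Ω) :
    R.Q (n + 1) ω = R.Q n ω -
      (η * (⟪g, feature H (R.prev n ω)⟫_ℝ
        + ⟪R.Q n ω, α • (R.condOpEst p n ω).adjoint (feature H (R.prev n ω))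
            - feature H (R.prev n ω)⟫_ℝ)) •
        (α • (R.condOpEst p n ω).adjoint (feature H (R.prev n ω)) - feature H (R.prev n ω)) := by
  rw [hR.update n ω, gradient_loss, smul_smul, condOpEst]
  congr 3
  rw [inner_sub_left, inner_add_left, real_inner_smul_left, inner_sub_right,
    real_inner_smul_right, ContinuousLinearMap.adjoint_inner_right]
  ring

variable [MeasurableSpace Ω]

/-- The error of the next estimate, relative to the fixed point `q` of the Bellman map of the
limit policy. The residual at `q` is pure noise `α ⟪q, ξ⟫`. -/
lemma update_sub_eq [Fintype A] (hR : R.IsRun p g α η) {Pr : Measure Ω} {n : ℕ} {ω : Ω}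
    {C : H →L[ℝ] H} (hC : R.condOp Pr n (R.policy n ω) = C) {q : H} (hq : g + α • C q = q) :
    R.Q (n + 1) ω - q = (R.Q n ω - q) -
      (η * (⟪α • R.xi Pr p n ω + (α • C - .id ℝ H).adjoint (feature H (R.prev n ω)),
          R.Q n ω - q⟫_ℝ + α * ⟪q, R.xi Pr p n ω⟫_ℝ)) •
        (α • R.xi Pr p n ω + (α • C - .id ℝ H).adjoint (feature H (R.prev n ω))) := by
  set φ := feature H (R.prev n ω) with hφ
  have hv : α • (R.condOpEst p n ω).adjoint φ - φ
      = α • R.xi Pr p n ω + (α • C - .id ℝ H).adjoint φ := by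
    refine ext_inner_right ℝ fun h => ?_
    rw [xi, hC, ← hφ]
    simp only [inner_sub_left, inner_add_left, real_inner_smul_left,
      ContinuousLinearMap.adjoint_inner_left, sub_apply, smul_apply, inner_sub_right,
      real_inner_smul_right, ContinuousLinearMap.id_apply]
    ring
  have hg : ⟪g, φ⟫_ℝ = -⟪q, (α • C - .id ℝ H).adjoint φ⟫_ℝ := by
    rw [ContinuousLinearMap.adjoint_inner_right, ← inner_neg_left]
    congr 1
    simp only [sub_apply, smul_apply, ContinuousLinearMap.id_apply, neg_sub]
    exact eq_sub_of_add_eq hq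
  rw [update_eq hR, ← hφ, hv, hg, sub_right_comm]
  congr 3
  rw [real_inner_comm (R.Q n ω - q), inner_sub_left, inner_add_right q, real_inner_smul_right]
  ring

lemma enorm_xi_sq_le (hκ : ∀ z : S × A, ⟪feature H z, feature H z⟫_ℝ ≤ B)
    (Pr : Measure Ω) (n : ℕ) (ω : Ω) :
    ‖R.xi Pr p n ω‖ₑ ^ 2 ≤ ENNReal.ofReal B *
      ‖R.condOp Pr n (R.policy n ω) - R.condOpEst p n ω‖ₑ ^ 2 := by
  have hB : 0 ≤ B := real_inner_self_nonneg.trans (hκ (R.prev n ω))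
  rw [enorm_sq_eq_ofReal, ← ofReal_norm, ← ENNReal.ofReal_pow (norm_nonneg _),
    ← ENNReal.ofReal_mul hB]
  apply ENNReal.ofReal_le_ofReal
  have h1 : ‖R.xi Pr p n ω‖ ≤ ‖R.condOp Pr n (R.policy n ω) - R.condOpEst p n ω‖ * √B := by
    refine (ContinuousLinearMap.le_opNorm _ _).trans ?_
    rw [LinearIsometryEquiv.norm_map, norm_sub_rev]
    gcongr
    exact norm_feature_le hκ _
  calc ‖R.xi Pr p n ω‖ ^ 2
      ≤ (‖R.condOp Pr n (R.policy n ω) - R.condOpEst p n ω‖ * √B) ^ 2 := by gcongr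
    _ = _ := by rw [mul_pow, Real.sq_sqrt hB, mul_comm]

lemma lintegral_Q_sq_ne_top [Fintype A] (hR : R.IsRun p g α η)
    (hκ : ∀ z : S × A, ⟪feature H z, feature H z⟫_ℝ ≤ B) {Pr : Measure Ω}
    [IsProbabilityMeasure Pr] (h0 : ∫⁻ ω, ‖R.Q 0 ω‖ₑ ^ 2 ∂Pr < ∞) (n : ℕ) :
    ∫⁻ ω, ‖R.Q n ω‖ₑ ^ 2 ∂Pr ≠ ∞ := by
  induction n with
  | zero => exact h0.ne
  | succ n ih =>
    obtain ⟨c, hc⟩ := exists_norm_condOpEst_le hR hκ n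
    set b := (|α| * c + 1) * √B with hb
    have hw : ∀ ω, ‖α • (R.condOpEst p n ω).adjoint (feature H (R.prev n ω))
        - feature H (R.prev n ω)‖ ≤ b := by
      intro ω
      have hφ := norm_feature_le hκ (R.prev n ω)
      have hc0 : 0 ≤ c := (norm_nonneg _).trans (hc ω)
      have h1 : ‖(R.condOpEst p n ω).adjoint (feature H (R.prev n ω))‖ ≤ c * √B := by
        refine (ContinuousLinearMap.le_opNorm _ _).trans ?_
        rw [LinearIsometryEquiv.norm_map]
        gcongr
        exact hc ω
      refine (norm_sub_le _ _).trans ?_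
      rw [norm_smul, Real.norm_eq_abs, hb, add_mul, one_mul, mul_assoc]
      gcongr
    have hQ : ∀ ω, ‖R.Q (n + 1) ω‖ ≤
        |η| * (‖g‖ * √B) * b + (1 + |η| * b * b) * ‖R.Q n ω‖ := by
      intro ω
      have hφ := norm_feature_le hκ (R.prev n ω)
      have hb0 : 0 ≤ b := (norm_nonneg _).trans (hw ω)
      rw [update_eq hR]
      refine (norm_sub_le _ _).trans ?_
      rw [norm_smul, norm_mul, Real.norm_eq_abs, Real.norm_eq_abs]
      have h1 : |⟪g, feature H (R.prev n ω)⟫_ℝ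
        + ⟪R.Q n ω, α • (R.condOpEst p n ω).adjoint (feature H (R.prev n ω))
            - feature H (R.prev n ω)⟫_ℝ| ≤ ‖g‖ * √B + ‖R.Q n ω‖ * b := by
        refine (abs_add_le _ _).trans (add_le_add ?_ ?_)
        · exact (abs_real_inner_le_norm _ _).trans (by gcongr)
        · exact (abs_real_inner_le_norm _ _).trans (by gcongr; exact hw ω)
      have h2 := mul_le_mul (mul_le_mul_of_nonneg_left h1 (abs_nonneg η)) (hw ω)
        (norm_nonneg _) (by positivity)
      linarith
    set a₁ := |η| * (‖g‖ * √B) * b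
    set a₂ := 1 + |η| * b * b
    have hQ2 : ∀ ω, ‖R.Q (n + 1) ω‖ₑ ^ 2 ≤
        ENNReal.ofReal (2 * a₁ ^ 2) + ENNReal.ofReal (2 * a₂ ^ 2) * ‖R.Q n ω‖ₑ ^ 2 := by
      intro ω
      rw [enorm_sq_eq_ofReal, enorm_sq_eq_ofReal, ← ENNReal.ofReal_mul (by positivity),
        ← ENNReal.ofReal_add (by positivity) (by positivity)]
      apply ENNReal.ofReal_le_ofReal
      calc ‖R.Q (n + 1) ω‖ ^ 2 ≤ (a₁ + a₂ * ‖R.Q n ω‖) ^ 2 := by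
            gcongr
            exact hQ ω
        _ ≤ 2 * (a₁ ^ 2 + (a₂ * ‖R.Q n ω‖) ^ 2) := add_sq_le
        _ = _ := by ring
    refine ((lintegral_mono hQ2).trans_lt ?_).ne
    rw [lintegral_add_left measurable_const, lintegral_const_mul' _ _ ENNReal.ofReal_ne_top,
      lintegral_const, measure_univ, mul_one]
    exact ENNReal.add_lt_top.2 ⟨ENNReal.ofReal_lt_top,
      ENNReal.mul_lt_top ENNReal.ofReal_lt_top (lt_top_iff_ne_top.2 ih)⟩

end

end Run

/-! ### The mean square recursion along a run -/

namespace Run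

variable {Ω H S A : Type*} [MeasurableSpace Ω] [NormedAddCommGroup H] [InnerProductSpace ℝ H]
  [CompleteSpace H] [RKHS ℝ H (S × A) ℝ] [MeasurableSpace H] [BorelSpace H] [MeasurableSpace S]
  [MeasurableSpace A]

/-- Conditioning on `z_{n-1}` identifies `Σ_{s'z}^ν` with `Σ_zz C`, where `C` is the transition
operator of `ν`; hence `Σ_zz⁻¹ Σ_{s'z}^ν = C`. -/
lemma condOp_eq {R : Run Ω H S A} {Pr : Measure Ω} [IsProbabilityMeasure Pr] {n : ℕ}
    (hφ : Measurable (feature H : S × A → H)) {B : ℝ}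
    (hκ : ∀ z : S × A, ⟪feature H z, feature H z⟫_ℝ ≤ B) {ν : S → A} (hν : Measurable ν)
    {K : Kernel (S × A) S} [IsMarkovKernel K] (hprev : Measurable (R.prev n))
    (hstate : Measurable (R.state n))
    (htr : Pr.map (fun ω => (R.prev n ω, R.state n ω)) = (Pr.map (R.prev n)).compProd K)
    {Szz : H →L[ℝ] H} (hinv : Szz.IsInvertible)
    (hzz : IsCrossCov Pr (fun ω => feature H (R.prev n ω)) (fun ω => feature H (R.prev n ω)) Szz)
    {C : H →L[ℝ] H} (hC : IsTransitionOp K ν C) : R.condOp Pr n ν = C := by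
  have := Measure.isProbabilityMeasure_map (μ := Pr) hprev.aemeasurable
  have hsz : IsCrossCov Pr (fun ω => feature H (R.state n ω, ν (R.state n ω)))
      (fun ω => feature H (R.prev n ω)) (Szz ∘L C) := by
    intro f h
    simp only [real_inner_comm f, real_inner_comm h, inner_feature]
    set F : (S × A) × S → ℝ := fun x => f (x.2, ν x.2) * h x.1 with hF
    have hFm : Measurable F :=
      ((measurable_apply hφ f).comp (measurable_snd.prodMk (hν.comp measurable_snd))).mul
        ((measurable_apply hφ h).comp measurable_fst)
    have hFb : ∀ x, ‖F x‖ ≤ ‖f‖ * √B * (‖h‖ * √B) := fun x => by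
      rw [hF, norm_mul]
      exact mul_le_mul (abs_apply_le hκ f _) (abs_apply_le hκ h _) (norm_nonneg _) (by positivity)
    refine ⟨.of_bound (hFm.comp (hprev.prodMk hstate)).aestronglyMeasurable _
      (Eventually.of_forall fun ω => hFb (R.prev n ω, R.state n ω)), ?_⟩
    have h1 : ∫ ω, f (R.state n ω, ν (R.state n ω)) * h (R.prev n ω) ∂Pr
        = ∫ x, F x ∂(Pr.map fun ω => (R.prev n ω, R.state n ω)) :=
      (integral_map (hprev.prodMk hstate).aemeasurable hFm.aestronglyMeasurable).symm
    rw [h1, htr, Measure.integral_compProd (.of_bound hFm.aestronglyMeasurable _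
      (Eventually.of_forall hFb))]
    have h2 : ∀ z, ∫ s, F (z, s) ∂(K z) = C f z * h z := fun z => by
      rw [hC f z, ← integral_mul_const]
    simp_rw [h2]
    have h3 : ∫ z, C f z * h z ∂(Pr.map (R.prev n)) = ∫ ω, C f (R.prev n ω) * h (R.prev n ω) ∂Pr :=
      integral_map hprev.aemeasurable
        ((measurable_apply hφ (C f)).mul (measurable_apply hφ h)).aestronglyMeasurable
    rw [h3, real_inner_comm, ContinuousLinearMap.comp_apply, (hzz (C f) h).2]
    simp only [real_inner_comm h, real_inner_comm (C f), inner_feature]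
  rw [condOp, hzz.crossCov_eq, hsz.crossCov_eq, ← ContinuousLinearMap.comp_assoc,
    hinv.inverse_comp_self, ContinuousLinearMap.id_comp]

section Assumptions

variable [Fintype A] {R : Run Ω H S A} {Pr : Measure Ω} [IsProbabilityMeasure Pr]
  {p : SamplingParams S A} {α η β m₄ B : ℝ} {g : H} {K : Kernel (S × A) S} [IsMarkovKernel K]
  {μ : S → A} {Szz Sxz Sxx : H →L[ℝ] H}

omit [BorelSpace H] [Fintype A] [IsProbabilityMeasure Pr] [IsMarkovKernel K] in
lemma Assumptions.isCrossCov_prev (hA : R.Assumptions Pr p α g K μ β m₄ Szz Sxz Sxx) :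
    ∀ᶠ n in atTop, IsCrossCov Pr (fun ω => feature H (R.prev n ω))
      (fun ω => feature H (R.prev n ω)) Szz := by
  obtain ⟨N, hN⟩ := eventually_atTop.1 hA.cov_zz
  refine eventually_atTop.2 ⟨N + 1, fun n hn => ?_⟩
  obtain ⟨m, rfl⟩ : ∃ m, n = m + 1 := ⟨n - 1, by omega⟩
  exact hN m (by omega)

omit [BorelSpace H] [Fintype A] [IsMarkovKernel K] in
lemma Assumptions.finiteDimensional (hA : R.Assumptions Pr p α g K μ β m₄ Szz Sxz Sxx)
    (hκ : ∀ z : S × A, ⟪feature H z, feature H z⟫_ℝ ≤ B) : FiniteDimensional ℝ H := by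
  obtain ⟨n, hn⟩ := hA.isCrossCov_prev.exists
  exact finiteDimensional_of_sigmaMin_pos hn
    (fun ω => by rw [← real_inner_self_eq_norm_sq]; exact hκ _) hA.pos_zz

omit [Fintype A] in
lemma Assumptions.condOp_eq (hA : R.Assumptions Pr p α g K μ β m₄ Szz Sxz Sxx)
    (hφ : Measurable (feature H : S × A → H))
    (hκ : ∀ z : S × A, ⟪feature H z, feature H z⟫_ℝ ≤ B) (hμ : Measurable μ)
    {C : H →L[ℝ] H} (hC : IsTransitionOp K μ C) :
    ∀ᶠ n in atTop, ∀ᵐ ω ∂Pr, R.condOp Pr n (R.policy n ω) = C := by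
  have := hA.finiteDimensional hκ
  filter_upwards [hA.isCrossCov_prev, hA.transition, hA.policy_eq] with n h1 h2 h3
  filter_upwards [h3] with ω hω
  rw [hω]
  exact Run.condOp_eq hφ hκ hμ (hA.measurable_prev n) (hA.measurable_state n) h2
    (isInvertible_of_sigmaMin_pos hA.pos_zz) h1 hC

omit [Fintype A] in
lemma Assumptions.exists_isTransitionOp (hA : R.Assumptions Pr p α g K μ β m₄ Szz Sxz Sxx)
    (hφ : Measurable (feature H : S × A → H))
    (hκ : ∀ z : S × A, ⟪feature H z, feature H z⟫_ℝ ≤ B) (hμ : Measurable μ) (hα : 0 < α) :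
    ∃ C : H →L[ℝ] H, IsTransitionOp K μ C ∧ (∀ f, ‖α • C f‖ ≤ β * ‖f‖) ∧
      0 < sigmaMin (curvature α C Szz Sxz Sxx) := by
  obtain ⟨n, h1, h2⟩ := (hA.policy_eq.and hA.contraction).exists
  obtain ⟨ω, h3, h4⟩ := (h1.and h2).exists
  rw [h3] at h4
  obtain ⟨C, hC, hCβ⟩ := BellmanRKHS.exists_isTransitionOp hφ hκ hμ K hα g h4
  obtain ⟨k, h5, h6⟩ := ((hA.condOp_eq hφ hκ hμ hC).and hA.pos_curvature).exists
  obtain ⟨ω', h7, h8⟩ := (h5.and h6).exists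
  rw [h7] at h8
  exact ⟨C, hC, hCβ, h8⟩

/-- The mean square error contracts by a factor `1 - η l / 2` at each late time, where `l` is the
minimum spectral value of the curvature, up to a term of order `η²` and the second moment of
`ξ_n`. -/
lemma Assumptions.lintegral_succ_le (hR : R.IsRun p g α η)
    (hA : R.Assumptions Pr p α g K μ β m₄ Szz Sxz Sxx)
    (hφ : Measurable (feature H : S × A → H))
    (hκ : ∀ z : S × A, ⟪feature H z, feature H z⟫_ℝ ≤ B) (hμ : Measurable μ)
    (hβ : β ≤ 1) (hm : 0 ≤ m₄) {C : H →L[ℝ] H} (hC : IsTransitionOp K μ C)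
    (hCβ : ∀ f, ‖α • C f‖ ≤ β * ‖f‖) {q : H} (hq : g + α • C q = q) {G : ℝ} (hqG : ‖q‖ ≤ G)
    (hη : 0 < η)
    (hηM : η * (4 * (8 * α ^ 4 * m₄ + 128 * B ^ 2)) ≤ sigmaMin (curvature α C Szz Sxz Sxx))
    (hηl : η * sigmaMin (curvature α C Szz Sxz Sxx) ≤ 2) :
    ∀ᶠ n in atTop, ∫⁻ ω, ‖R.Q (n + 1) ω - q‖ₑ ^ 2 ∂Pr ≤
      ENNReal.ofReal (1 - η * sigmaMin (curvature α C Szz Sxz Sxx) / 2)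
          * ∫⁻ ω, ‖R.Q n ω - q‖ₑ ^ 2 ∂Pr
        + (ENNReal.ofReal (η ^ 2 * (α ^ 2 * G ^ 2 * (m₄ + (8 * α ^ 4 * m₄ + 128 * B ^ 2))))
          + ENNReal.ofReal (η * (α ^ 2 * G ^ 2)) * ∫⁻ ω, ‖R.xi Pr p n ω‖ₑ ^ 2 ∂Pr) := by
  have := hA.finiteDimensional hκ
  filter_upwards [hA.isCrossCov_prev, hA.condOp_eq hφ hκ hμ hC, hA.measurable_xi, hA.cov_xz,
    hA.cov_xx, hA.moment, hA.independence] with n hzz hcond hxi hxz hxx hmom hind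
  set D : H →L[ℝ] H := α • C - .id ℝ H with hD
  set l := sigmaMin (curvature α C Szz Sxz Sxx) with hl
  have hDn : ‖D.adjoint‖ ≤ 2 := by
    rw [LinearIsometryEquiv.norm_map]
    refine D.opNorm_le_bound (by norm_num) fun f => ?_
    have h1 : D f = α • C f - f := by simp [hD]
    rw [h1]
    nlinarith [norm_sub_le (α • C f) f, hCβ f, norm_nonneg f]
  have hY : ∀ z : S × A, ‖D.adjoint (feature H z)‖ ^ 2 ≤ 4 * B := fun z => by
    have h1 : ‖D.adjoint (feature H z)‖ ≤ 2 * ‖feature H z‖ :=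
      (D.adjoint.le_opNorm _).trans (by gcongr)
    have h2 : ‖feature H z‖ ^ 2 ≤ B := by rw [← real_inner_self_eq_norm_sq]; exact hκ z
    calc ‖D.adjoint (feature H z)‖ ^ 2 ≤ (2 * ‖feature H z‖) ^ 2 := by gcongr
      _ ≤ 4 * B := by rw [mul_pow]; linarith
  have hcov := isCrossCov_curvature (α := α) (C := C) hzz hxz hxx
  rw [← hD] at hcov
  have hYm := hA.measurable_prev n
  have hprod : Measurable fun ω => (R.prev n ω, R.xi Pr p n ω) := hYm.prodMk hxi
  have hindep : IndepFun (R.Q n) (fun ω => (R.prev n ω, R.xi Pr p n ω)) Pr := by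
    rw [IndepFun_iff_Indep]
    exact (indep_of_indep_of_le_right hind
      (le_iSup₂_of_le (f := fun k (_ : k ≤ n) => MeasurableSpace.comap (R.Q k) _)
        n le_rfl le_rfl)).symm
  -- the next error as a function of the current estimate and of the fresh randomness
  set Ψ : H × ((S × A) × H) → ℝ≥0∞ := fun x =>
    ‖(x.1 - q) - (η * (⟪α • x.2.2 + D.adjoint (feature H x.2.1), x.1 - q⟫_ℝ
      + α * ⟪q, x.2.2⟫_ℝ)) • (α • x.2.2 + D.adjoint (feature H x.2.1))‖ₑ ^ 2 with hΨ
  have hΨm : Measurable Ψ := by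
    have h1 : Measurable fun x : H × ((S × A) × H) =>
        α • x.2.2 + D.adjoint (feature H x.2.1) :=
      (measurable_snd.snd.const_smul α).add
        (D.adjoint.continuous.measurable.comp (hφ.comp measurable_snd.fst))
    have h2 : Measurable fun x : H × ((S × A) × H) => x.1 - q := measurable_fst.sub_const q
    have h3 : Measurable fun x : H × ((S × A) × H) => ⟪q, x.2.2⟫_ℝ :=
      measurable_const.inner measurable_snd.snd
    exact ((h2.sub ((((h1.inner h2).add (h3.const_mul α)).const_mul η).smul h1)).enorm).pow_const 2
  calc ∫⁻ ω, ‖R.Q (n + 1) ω - q‖ₑ ^ 2 ∂Pr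
      = ∫⁻ ω, Ψ (R.Q n ω, (R.prev n ω, R.xi Pr p n ω)) ∂Pr := by
        refine lintegral_congr_ae ?_
        filter_upwards [hcond] with ω hω
        rw [update_sub_eq hR hω hq]
    _ = ∫⁻ x, Ψ x ∂(Pr.map fun ω => (R.Q n ω, (R.prev n ω, R.xi Pr p n ω))) :=
        (lintegral_map hΨm ((hA.measurable_Q n).prodMk hprod)).symm
    _ = ∫⁻ x, ∫⁻ y, Ψ (x, y) ∂(Pr.map fun ω => (R.prev n ω, R.xi Pr p n ω))
          ∂(Pr.map (R.Q n)) := by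
        rw [hindep.map_prod_eq_prod_map_map (hA.measurable_Q n).aemeasurable hprod.aemeasurable,
          lintegral_prod _ hΨm.aemeasurable]
    _ ≤ ∫⁻ x, (ENNReal.ofReal (1 - η * l / 2) * ‖x - q‖ₑ ^ 2
          + (ENNReal.ofReal (η ^ 2 * (α ^ 2 * G ^ 2 * (m₄ + (8 * α ^ 4 * m₄ + 128 * B ^ 2))))
            + ENNReal.ofReal (η * (α ^ 2 * G ^ 2)) * ∫⁻ ω, ‖R.xi Pr p n ω‖ₑ ^ 2 ∂Pr))
          ∂(Pr.map (R.Q n)) := by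
        refine lintegral_mono fun x => ?_
        have hx : Measurable fun y => Ψ (x, y) := hΨm.comp measurable_prodMk_left
        rw [lintegral_map hx hprod]
        have hsq := hcov.integral_sq (x - q)
        refine lintegral_step_le hxi hm hmom (fun ω => hY _) hqG (x - q) hsq.1 ?_ hη hηM hηl
        rw [hsq.2]
        exact sigmaMin_mul_norm_sq_le _ _
    _ = _ := by
        have hn : Measurable fun x : H => ‖x - q‖ₑ ^ 2 :=
          ((measurable_id.sub_const q).enorm).pow_const 2
        have := Measure.isProbabilityMeasure_map (μ := Pr) (hA.measurable_Q n).aemeasurable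
        rw [lintegral_add_left (hn.const_mul _), lintegral_const, measure_univ, mul_one,
          lintegral_const_mul _ hn, lintegral_map hn (hA.measurable_Q n)]

/-- The asymptotic mean square distance of the estimates to the fixed point of the Bellman map of
the limit policy. -/
lemma Assumptions.limsup_le (hR : R.IsRun p g α η)
    (hA : R.Assumptions Pr p α g K μ β m₄ Szz Sxz Sxx)
    (hφ : Measurable (feature H : S × A → H))
    (hκ : ∀ z : S × A, ⟪feature H z, feature H z⟫_ℝ ≤ B) (hμ : Measurable μ)
    (hβ : β ≤ 1) (hm : 0 ≤ m₄) {C : H →L[ℝ] H} (hC : IsTransitionOp K μ C)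
    (hCβ : ∀ f, ‖α • C f‖ ≤ β * ‖f‖) {q : H} (hq : g + α • C q = q) {G : ℝ} (hqG : ‖q‖ ≤ G)
    {l : ℝ} (hl : l = sigmaMin (curvature α C Szz Sxz Sxx)) (hl0 : 0 < l) (hη : 0 < η)
    (hηM : η * (4 * (8 * α ^ 4 * m₄ + 128 * B ^ 2)) ≤ l) (hηl : η * l ≤ 2) :
    limsup (fun n => ∫⁻ ω, ‖R.Q n ω - q‖ₑ ^ 2 ∂Pr) atTop ≤
      ENNReal.ofReal (2 * (α ^ 2 * G ^ 2 * (m₄ + (8 * α ^ 4 * m₄ + 128 * B ^ 2))) / l * η)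
        + ENNReal.ofReal (2 * (α ^ 2 * G ^ 2 * B) / l) * limsup (fun n =>
          ∫⁻ ω, ‖R.condOp Pr n (R.policy n ω) - R.condOpEst p n ω‖ₑ ^ 2 ∂Pr) atTop := by
  have hfin : ∀ n, ∫⁻ ω, ‖R.Q n ω - q‖ₑ ^ 2 ∂Pr ≠ ∞ := fun n => by
    have h1 : ∀ ω, ‖R.Q n ω - q‖ₑ ^ 2 ≤ 2 * ‖R.Q n ω‖ₑ ^ 2 + 2 * ‖q‖ₑ ^ 2 := fun ω => by
      simpa [sub_eq_add_neg] using enorm_add_sq_le (R.Q n ω) (-q)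
    refine ((lintegral_mono h1).trans_lt ?_).ne
    rw [lintegral_add_right _ measurable_const, lintegral_const_mul' _ _ (by simp),
      lintegral_const, measure_univ, mul_one]
    exact ENNReal.add_lt_top.2 ⟨ENNReal.mul_lt_top (by simp)
      (lt_top_iff_ne_top.2 (lintegral_Q_sq_ne_top hR hκ hA.init n)),
      ENNReal.mul_lt_top (by simp) (by simp)⟩
  set P := α ^ 2 * G ^ 2 * (m₄ + (8 * α ^ 4 * m₄ + 128 * B ^ 2)) with hP
  set k := α ^ 2 * G ^ 2 with hk
  have hrec := hA.lintegral_succ_le hR hφ hκ hμ hβ hm hC hCβ hq hqG hη (hl ▸ hηM) (hl ▸ hηl)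
  rw [← hl] at hrec
  have hθ : 0 < η * l / 2 := by positivity
  refine (limsup_le_of_affine_recursion hθ (by linarith) hfin hrec).trans ?_
  rw [limsup_const_add_const_mul _ _ ENNReal.ofReal_ne_top]
  set δ := fun n => ∫⁻ ω, ‖R.condOp Pr n (R.policy n ω) - R.condOpEst p n ω‖ₑ ^ 2 ∂Pr
  have hxi : limsup (fun n => ∫⁻ ω, ‖R.xi Pr p n ω‖ₑ ^ 2 ∂Pr) atTop ≤
      ENNReal.ofReal B * limsup δ atTop := by
    rw [← ENNReal.limsup_const_mul_of_ne_top ENNReal.ofReal_ne_top]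
    refine limsup_le_limsup (Eventually.of_forall fun n => ?_)
    dsimp only
    rw [← lintegral_const_mul' _ _ ENNReal.ofReal_ne_top]
    exact lintegral_mono fun ω => enorm_xi_sq_le hκ Pr n ω
  have hP0 : 0 ≤ P := by positivity
  have hk0 : 0 ≤ k := by positivity
  calc ENNReal.ofReal (η * l / 2)⁻¹ * (ENNReal.ofReal (η ^ 2 * P) + ENNReal.ofReal (η * k)
        * limsup (fun n => ∫⁻ ω, ‖R.xi Pr p n ω‖ₑ ^ 2 ∂Pr) atTop)
      ≤ ENNReal.ofReal (η * l / 2)⁻¹ * (ENNReal.ofReal (η ^ 2 * P) + ENNReal.ofReal (η * k)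
        * (ENNReal.ofReal B * limsup δ atTop)) := by gcongr
    _ = _ := by
      have h1 : ENNReal.ofReal (η * l / 2)⁻¹ * ENNReal.ofReal (η ^ 2 * P)
          = ENNReal.ofReal (2 * P / l * η) := by
        rw [← ENNReal.ofReal_mul (by positivity)]
        congr 1
        field_simp
      have h2 : ENNReal.ofReal (η * l / 2)⁻¹ * ENNReal.ofReal (η * k) * ENNReal.ofReal B
          = ENNReal.ofReal (2 * (k * B) / l) := by
        rw [← ENNReal.ofReal_mul (by positivity), ← ENNReal.ofReal_mul (by positivity)]
        congr 1
        field_simp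
      rw [mul_add, h1, ← h2]
      ring

end Assumptions

end Run

end BellmanRKHS

/-! ### The asymptotic error bound -/

theorem mainTheorem5
    {S A H : Type*} [MeasurableSpace S]
    [Fintype A] [Nonempty A] [MeasurableSpace A] [MeasurableSingletonClass A]
    [NormedAddCommGroup H] [InnerProductSpace ℝ H] [CompleteSpace H]
    [RKHS ℝ H (S × A) ℝ] [MeasurableSpace H] [BorelSpace H]
    -- the kernel is measurable and bounded
    (hφ : Measurable (BellmanRKHS.feature H : S × A → H))
    (Bκ : ℝ) (hBκ : 0 < Bκ)
    (hκ : ∀ z : S × A, ⟪BellmanRKHS.feature H z, BellmanRKHS.feature H z⟫_ℝ ≤ Bκ)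
    -- discount factor, one-step loss, transition probability
    (α : ℝ) (hα : 0 < α) (g : H) (K : Kernel (S × A) S) [IsMarkovKernel K]
    -- limit policy, contraction modulus, fourth moment, covariance operators
    (μ : S → A) (hμ : Measurable μ) (β : ℝ) (hβ : β ∈ Set.Ioo (0 : ℝ) 1)
    (m₄ : ℝ) (hm₄ : 0 < m₄) (Szz Sxz Sxx : H →L[ℝ] H) :
    ∃ η₀ Δ₄ Δ₅ : ℝ, 0 < η₀ ∧ 0 < Δ₄ ∧ 0 < Δ₅ ∧
      ∀ η : ℝ, 0 < η → η < η₀ →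
      ∀ (Ω : Type*) [MeasurableSpace Ω] (Pr : Measure Ω) [IsProbabilityMeasure Pr]
        (p : BellmanRKHS.SamplingParams S A) (R : BellmanRKHS.Run Ω H S A),
        R.IsRun p g α η →
        R.Assumptions Pr p α g K μ β m₄ Szz Sxz Sxx →
        -- fixed points of the classical Bellman maps of the policies `μ_n`, for large `n`
        ∀ Qfix : ℕ → Ω → H,
          (∀ᶠ n in atTop, ∀ᵐ ω ∂Pr, BellmanRKHS.IsFixedPointIn
            (BellmanRKHS.bellmanPolicy K (g : S × A → ℝ) α (R.policy n ω)) (Qfix n ω)) →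
        -- a fixed point of the classical greedy Bellman map
        ∀ Qstar : H,
          BellmanRKHS.IsFixedPointIn
            (BellmanRKHS.bellmanGreedy K (g : S × A → ℝ) α) Qstar →
        limsup (fun n => ∫⁻ ω, ‖R.Q n ω - Qstar‖ₑ ^ 2 ∂Pr) atTop ≤
          ENNReal.ofReal (Δ₄ * η)
            + ENNReal.ofReal Δ₅ * limsup (fun n =>
                ∫⁻ ω, ‖R.condOp Pr n (R.policy n ω) - R.condOpEst p n ω‖ₑ ^ 2 ∂Pr) atTop
            + 2 * limsup (fun n => ∫⁻ ω, ‖Qfix n ω - Qstar‖ₑ ^ 2 ∂Pr) atTop := by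
  have hβ1 : 0 < 1 - β := by linarith [hβ.2]
  -- The transition operator of `μ` is determined by `H`, `K` and `μ`, so that constants read off
  -- from it do not depend on the run; without such an operator there is no run to consider.
  by_cases hex : ∃ C : H →L[ℝ] H, BellmanRKHS.IsTransitionOp K μ C ∧
      0 < BellmanRKHS.sigmaMin (BellmanRKHS.curvature α C Szz Sxz Sxx)
  swap
  · refine ⟨1, 1, 1, one_pos, one_pos, one_pos, ?_⟩
    intro η _ _ Ω _ Pr _ p R _ hA
    obtain ⟨C, hC, -, hpos⟩ := hA.exists_isTransitionOp hφ hκ hμ hα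
    exact absurd ⟨C, hC, hpos⟩ hex
  obtain ⟨C, hC, hl0⟩ := hex
  obtain ⟨l, hl⟩ : ∃ l, l = BellmanRKHS.sigmaMin (BellmanRKHS.curvature α C Szz Sxz Sxx) :=
    ⟨_, rfl⟩
  rw [← hl] at hl0
  obtain ⟨G, hG⟩ : ∃ G, G = ‖g‖ / (1 - β) := ⟨_, rfl⟩
  obtain ⟨M, hM⟩ : ∃ M, M = 8 * α ^ 4 * m₄ + 128 * Bκ ^ 2 := ⟨_, rfl⟩
  have hM0 : 0 < M := by rw [hM]; positivity
  refine ⟨min (l / (4 * M)) (2 / l), 2 * (2 * (α ^ 2 * G ^ 2 * (m₄ + M)) / l) + 1,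
    2 * (2 * (α ^ 2 * G ^ 2 * Bκ) / l) + 1, by positivity, by positivity, by positivity, ?_⟩
  intro η hη hη0 Ω _ Pr _ p R hR hA Qfix hQfix Qstar _
  obtain ⟨C', hC', hCβ, -⟩ := hA.exists_isTransitionOp hφ hκ hμ hα
  obtain rfl : C = C' := hC.unique hC'
  have hηM : η * (4 * M) ≤ l :=
    (le_div_iff₀ (by positivity)).1 (hη0.le.trans (min_le_left _ _))
  have hηl : η * l ≤ 2 := (le_div_iff₀ hl0).1 (hη0.le.trans (min_le_right _ _))
  -- for large `n` all fixed points satisfy the same affine equation, which has one solution `q`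
  have hfix : ∀ᶠ n in atTop, ∀ᵐ ω ∂Pr, g + α • C (Qfix n ω) = Qfix n ω := by
    filter_upwards [hQfix, hA.policy_eq] with n h1 h2
    filter_upwards [h1, h2] with ω h3 h4
    rw [h4] at h3
    exact hC.eq_of_isFixedPointIn h3
  obtain ⟨n₀, hn₀⟩ := hfix.exists
  obtain ⟨ω₀, hω₀⟩ := hn₀.exists
  obtain ⟨q, hq⟩ : ∃ q, g + α • C q = q := ⟨_, hω₀⟩
  have huniq : ∀ q', g + α • C q' = q' → q' = q := by
    intro q' hq'
    have h1 : q' - q = α • C (q' - q) := by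
      conv_lhs => rw [← hq', ← hq]
      rw [map_sub, smul_sub]
      abel
    have h2 := hCβ (q' - q)
    rw [← h1] at h2
    have h3 : ‖q' - q‖ ≤ 0 := by
      by_contra hcon
      push Not at hcon
      nlinarith
    exact sub_eq_zero.1 (norm_le_zero_iff.1 h3)
  have hqG : ‖q‖ ≤ G := by
    rw [hG, le_div_iff₀ hβ1]
    have h1 : ‖q‖ ≤ ‖g‖ + ‖α • C q‖ := by
      conv_lhs => rw [← hq]
      exact norm_add_le _ _
    have h2 := hCβ q
    linarith
  have hmain := hA.limsup_le hR hφ hκ hμ hβ.2.le hm₄.le hC hCβ hq hqG hl hl0 hη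
    (hM ▸ hηM) hηl
  rw [← hM] at hmain
  have hstar : limsup (fun n => ∫⁻ ω, ‖Qfix n ω - Qstar‖ₑ ^ 2 ∂Pr) atTop = ‖q - Qstar‖ₑ ^ 2 := by
    rw [limsup_congr (v := fun _ => ‖q - Qstar‖ₑ ^ 2), limsup_const]
    filter_upwards [hfix] with n hn
    rw [lintegral_congr_ae (g := fun _ => ‖q - Qstar‖ₑ ^ 2), lintegral_const, measure_univ, mul_one]
    filter_upwards [hn] with ω hω
    rw [huniq _ hω]
  have hsplit : ∀ n, ∫⁻ ω, ‖R.Q n ω - Qstar‖ₑ ^ 2 ∂Pr ≤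
      2 * ‖q - Qstar‖ₑ ^ 2 + 2 * ∫⁻ ω, ‖R.Q n ω - q‖ₑ ^ 2 ∂Pr := by
    intro n
    have h1 : ∀ ω, ‖R.Q n ω - Qstar‖ₑ ^ 2 ≤
        2 * ‖q - Qstar‖ₑ ^ 2 + 2 * ‖R.Q n ω - q‖ₑ ^ 2 := fun ω => by
      rw [← sub_add_sub_cancel (R.Q n ω) q Qstar, add_comm (2 * ‖q - Qstar‖ₑ ^ 2)]
      exact BellmanRKHS.enorm_add_sq_le _ _
    refine (lintegral_mono h1).trans_eq ?_
    rw [lintegral_add_left measurable_const, lintegral_const, measure_univ, mul_one,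
      lintegral_const_mul' _ _ (by simp)]
  rw [hstar]
  set δ := limsup (fun n =>
    ∫⁻ ω, ‖R.condOp Pr n (R.policy n ω) - R.condOpEst p n ω‖ₑ ^ 2 ∂Pr) atTop
  have htwo : (2 : ℝ≥0∞) = ENNReal.ofReal 2 := by simp
  calc limsup (fun n => ∫⁻ ω, ‖R.Q n ω - Qstar‖ₑ ^ 2 ∂Pr) atTop
      ≤ limsup (fun n => 2 * ‖q - Qstar‖ₑ ^ 2 + 2 * ∫⁻ ω, ‖R.Q n ω - q‖ₑ ^ 2 ∂Pr) atTop :=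
        limsup_le_limsup (Eventually.of_forall hsplit)
    _ = 2 * ‖q - Qstar‖ₑ ^ 2 + 2 * limsup (fun n => ∫⁻ ω, ‖R.Q n ω - q‖ₑ ^ 2 ∂Pr) atTop :=
        BellmanRKHS.limsup_const_add_const_mul _ _ (by simp) _
    _ ≤ 2 * ‖q - Qstar‖ₑ ^ 2 + 2 * (ENNReal.ofReal (2 * (α ^ 2 * G ^ 2 * (m₄ + M)) / l * η)
          + ENNReal.ofReal (2 * (α ^ 2 * G ^ 2 * Bκ) / l) * δ) := by gcongr
    _ = ENNReal.ofReal (2 * (2 * (α ^ 2 * G ^ 2 * (m₄ + M)) / l) * η)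
          + ENNReal.ofReal (2 * (2 * (α ^ 2 * G ^ 2 * Bκ) / l)) * δ
          + 2 * ‖q - Qstar‖ₑ ^ 2 := by
        rw [mul_assoc 2 _ η, ENNReal.ofReal_mul zero_le_two, ENNReal.ofReal_mul zero_le_two,
          ← htwo]
        ring
    _ ≤ _ := by
        gcongr <;> linarith
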